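/- **Setting.** Let $T:X\to X$ be a measurable transformation, $Y\subset X$, and let $\varphi:Y\to\{1,2,\dots\}$ be a measurable return time (not necessarily the first one) such that $F(y)=T^{\varphi(y)}(y)\in Y$ for all $y\in Y$. Let $\mu$ be an $F$-invariant ergodic probability measure on $Y$ with $\varphi\in L^1(\mu)$ and put $\bar\varphi=\int_Y\varphi\,d\mu$. On the tower $\Delta=\{(y,\ell)\in Y\times\mathbb Z:0\le\ell\le\varphi(y)-1\}$ let $\mu_\Delta=(\mu\times\text{counting})/\bar\varphi$, and let $\mu_X=\pi_*\mu_\Delta$ where $\pi(y,\ell)=T^\ell y$. For $v\in L^1(X)$, $w\in L^\infty(X)$ (with respect to $\mu_X$) let $$\rho_{v,w}(n)=\int_X v\;w\circ T^n\,d\mu_X-\int_X v\,d\mu_X\int_X w\,d\mu_X .$$ Let $R$ be the transfer operator of $F$, i.e. $\int_Y (Rv)\,w\,d\mu=\int_Y v\;w\circ F\,d\mu$ for $v\in L^1(Y)$, $w\in L^\infty(Y)$, and let $R_nv=R(1_{\{\varphi=n\}}v)$, $n\ge1$. Let $\mathcal B(Y)\subset L^1(Y)$ be a (complex) Banach space of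 functions containing the constants, with $|v|_1\le\|v\|$. Assume that $\mathcal B(Y)$ is continuously embedded in $L^\infty(Y)$, and that the inducing scheme is *excellent* with respect to $\mathcal B(Y)$: * each $R_n$ is a bounded operator on $\mathcal B(Y)$, and there is $C$ with $\|R_n\|\le C\mu(\varphi=n)$ for all $n\ge1$; * with $R(z)=\sum_{n\ge1}R_nz^n$ for $|z|\le1$: $1$ is a simple eigenvalue of $R(1)$ (of algebraic multiplicity one), isolated in the spectrum of $R(1)$; and $1$ is not in the spectrum of $R(z)$ for $|z|\le1$, $z\ne1$. A function $\hat v:Y\to\mathbb R$ is *derived* from $v:X\to\mathbb R$ if for every $n\ge1$ there is $j\in\{0,\dots,n-1\}$ with $\hat v(y)=v(T^jy)$ for all $y$ with $\varphi(y)=n$. An observable $v\in L^1(X)$ is *exchangeable* if the functions derived from it form a bounded subset of $\mathcal B(Y)$; $\|v\|$ denotes the supremum of their norms. For sequences, $u_n\ll b_n$ means that there is a constant $K$ with $u_n\le Kb_n$ for all $n\ge1$. We write $|\rho(n)|\ll b_n$ if there is a constant $C$ such that $|\rho_{v,w}(n)|\le C\|v\||w|_\infty b_n$ for all exchangeable $v\in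 L^1(X)$, all $w\in L^\infty(X)$ and all $n\ge1$. **Statement.** 1. Let $c>0$ and $\gamma\in(0,1)$. If $\mu(\varphi>n)\ll e^{-cn^\gamma}$, then $|\rho(n)|\ll n^{1+\epsilon}e^{-cn^\gamma}$ for every $\epsilon>0$. 2. Let $g(n)$, $n\ge1$, be an increasing real sequence such that $g(n)=O(n^{1-\delta})$ for some $\delta>0$ and such that $k\mapsto k^{-1}(g(k)-(1+\eta)\log k)$ is eventually decreasing for some $\eta>0$. If $\mu(\varphi>n)\ll e^{-g(n)}$, then for every $\epsilon>0$ $$|\rho(n)|\ll n^{1+\epsilon}e^{-g(n)}+\sum_{j>n}\mu(\varphi>j).$$ In particular, for every $\epsilon>0$ such that $\sum_{j>n}e^{-g(j)}\ll n^{1+\epsilon}e^{-g(n)}$, we have $|\rho(n)|\ll n^{1+\epsilon}e^{-g(n)}$. ("Increasing" and "decreasing" are meant in the weak sense.) -/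

import Mathlib

open MeasureTheory Set Filter
open scoped ENNReal NNReal

/-- `u n ≪ b n`: there is a constant `K` with `u n ≤ K * b n` for all `n ≥ 1`. -/
def Dominated (u b : ℕ → ℝ) : Prop :=
  ∃ K : ℝ, ∀ n : ℕ, 1 ≤ n → u n ≤ K * b n

/-- A measurable transformation `T` of `X`, a subset `Y` of `X`, an integrable return time
`φ : Y → {1, 2, ...}` (not necessarily the first return time) with `T ^ φ(y) (y) ∈ Y`, and a
probability measure `μ` on `Y` that is invariant and ergodic under `y ↦ T ^ φ(y) (y)`. -/
structure InducingScheme (X : Type*) [MeasurableSpace X] where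
  T : X → X
  measurable_T : Measurable T
  Y : Set X
  φ : Y → ℕ
  measurable_φ : Measurable φ
  one_le_φ : ∀ y, 1 ≤ φ y
  mapsTo : ∀ y : Y, T^[φ y] (y : X) ∈ Y
  μ : Measure Y
  isProbabilityMeasure : IsProbabilityMeasure μ
  ergodic : Ergodic (fun y : Y => (⟨T^[φ y] (y : X), mapsTo y⟩ : Y)) μ
  integrable_φ : Integrable (fun y => (φ y : ℝ)) μ

/-- A complex normed space `B` of (classes of) functions in `L¹(μ)`, with `|v|₁ ≤ ‖v‖`, that
contains the constant functions. -/
structure ObservableSpace {Y : Type*} [MeasurableSpace Y] (μ : Measure Y)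
    (B : Type*) [NormedAddCommGroup B] [NormedSpace ℂ B] where
  toL1 : B →ₗ[ℂ] Lp ℂ 1 μ
  injective : Function.Injective toL1
  norm_le : ∀ b, ‖toL1 b‖ ≤ ‖b‖
  const_mem : ∀ c : ℂ, ∃ b, (toL1 b : Y → ℂ) =ᵐ[μ] fun _ => c

/-- `B` is (continuously) embedded in `L^∞(μ)`. -/
def ObservableSpace.EmbedsInLinfty {Y : Type*} [MeasurableSpace Y] {μ : Measure Y}
    {B : Type*} [NormedAddCommGroup B] [NormedSpace ℂ B] (E : ObservableSpace μ B) : Prop :=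
  ∃ C : ℝ≥0, ∀ b : B, eLpNorm (E.toL1 b : Y → ℂ) ⊤ μ ≤ C * ‖b‖ₑ

/-- `c` is a simple eigenvalue of `A`, isolated in the spectrum. Simple means algebraic
multiplicity one, that is, the spectral projection of `A` at `c` has rank one; for an isolated
point of the spectrum this says that the eigenspace is one-dimensional and is complemented by the
range of `A - c`. -/
def IsSimpleIsolatedEigenvalue {B : Type*} [NormedAddCommGroup B] [NormedSpace ℂ B]
    (A : B →L[ℂ] B) (c : ℂ) : Prop :=
  (∃ r : ℝ, 0 < r ∧ ∀ l ∈ spectrum ℂ A, ‖l - c‖ < r → l = c) ∧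
  Module.finrank ℂ (LinearMap.ker ((A - c • (1 : B →L[ℂ] B) : B →L[ℂ] B) : B →ₗ[ℂ] B)) = 1 ∧
  IsCompl (LinearMap.ker ((A - c • (1 : B →L[ℂ] B) : B →L[ℂ] B) : B →ₗ[ℂ] B))
    (LinearMap.range ((A - c • (1 : B →L[ℂ] B) : B →L[ℂ] B) : B →ₗ[ℂ] B))

namespace InducingScheme

variable {X : Type*} [MeasurableSpace X] (S : InducingScheme X)

/-- The induced map `F y = T ^ φ(y) (y)`. -/
def F (y : S.Y) : S.Y := ⟨S.T^[S.φ y] (y : X), S.mapsTo y⟩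

/-- The tail `μ(φ > n)`. -/
noncomputable def tail (n : ℕ) : ℝ := S.μ.real {y | n < S.φ y}

/-! ### The tower and the measure on `X` -/

/-- The tower `Δ = {(y, l) : 0 ≤ l ≤ φ(y) - 1}`. -/
abbrev Tower : Type _ := {p : S.Y × ℕ // p.2 < S.φ p.1}

/-- The probability measure `(μ × counting) / ∫ φ dμ` on the tower. -/
noncomputable def towerMeasure : Measure S.Tower :=
  (∫⁻ y, (S.φ y : ℝ≥0∞) ∂S.μ)⁻¹ •
    Measure.comap (Subtype.val : S.Tower → S.Y × ℕ) (S.μ.prod Measure.count)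

/-- The semiconjugacy `π (y, l) = T ^ l (y)` from the tower to `X`. -/
def proj (p : S.Tower) : X := S.T^[p.1.2] (p.1.1 : X)

/-- The measure `μ_X = π_* μ_Δ` on `X`. -/
noncomputable def μX : Measure X := S.towerMeasure.map S.proj

/-- The correlation function `ρ_{v,w}(n) = ∫ v (w ∘ Tⁿ) dμ_X - ∫ v dμ_X ∫ w dμ_X`. -/
noncomputable def corr (v w : X → ℝ) (n : ℕ) : ℝ :=
  (∫ x, v x * w (S.T^[n] x) ∂S.μX) - (∫ x, v x ∂S.μX) * ∫ x, w x ∂S.μX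

/-! ### Transfer operators and excellent inducing schemes -/

/-- `u = R v`, where `R` is the transfer operator of `F`, given by
`∫ (R v) w dμ = ∫ v (w ∘ F) dμ` for all `w ∈ L^∞(μ)`. -/
def IsTransfer (u v : S.Y → ℂ) : Prop :=
  ∀ w : S.Y → ℂ, MemLp w ⊤ S.μ → ∫ y, u y * w y ∂S.μ = ∫ y, v y * w (S.F y) ∂S.μ

variable {B : Type*} [NormedAddCommGroup B] [NormedSpace ℂ B] (E : ObservableSpace S.μ B)

/-- The bounded operators `Rn n` on `B` are the restrictions to `B` of `v ↦ R (1_{φ = n} v)`.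
(For `n = 0` this says `Rn 0 = 0`.) -/
def IsRenewalFamily (Rn : ℕ → B →L[ℂ] B) : Prop :=
  ∀ (n : ℕ) (b : B),
    S.IsTransfer (E.toL1 (Rn n b)) ({y | S.φ y = n}.indicator (E.toL1 b : S.Y → ℂ))

/-- The inducing scheme is excellent with respect to `B`: the operators `R_n = R 1_{φ = n}` are
bounded on `B` with `‖R_n‖ ≪ μ(φ = n)`; and for `R(z) = ∑ zⁿ R_n`, the eigenvalue `1` of `R(1)` is
simple and isolated, while `1` is not in the spectrum of `R(z)` for `|z| ≤ 1`, `z ≠ 1`. -/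
def IsExcellent : Prop :=
  ∃ Rn : ℕ → B →L[ℂ] B, S.IsRenewalFamily E Rn ∧
    (∃ C : ℝ, ∀ n, 1 ≤ n → ‖Rn n‖ ≤ C * S.μ.real {y | S.φ y = n}) ∧
    IsSimpleIsolatedEigenvalue (∑' n, Rn n) 1 ∧
    ∀ z : ℂ, ‖z‖ ≤ 1 → z ≠ 1 → (1 : ℂ) ∉ spectrum ℂ (∑' n, z ^ n • Rn n)

/-! ### Exchangeable observables -/

/-- The set of functions on `Y` derived from `v`: for each `n ≥ 1` there is `0 ≤ j ≤ n - 1` with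
`vhat y = v (T ^ j y)` whenever `φ y = n`. -/
def derived (v : X → ℝ) : Set (S.Y → ℝ) :=
  {vhat | ∀ n : ℕ, 1 ≤ n → ∃ j < n, ∀ y : S.Y, S.φ y = n → vhat y = v (S.T^[j] (y : X))}

/-- `b ∈ B` is the class of the real function `u` on `Y`. -/
def Represents (b : B) (u : S.Y → ℝ) : Prop :=
  (E.toL1 b : S.Y → ℂ) =ᵐ[S.μ] fun y => (u y : ℂ)

/-- `v` is exchangeable: the functions derived from `v` form a bounded subset of `B`. -/
def Exchangeable (v : X → ℝ) : Prop :=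
  ∃ M : ℝ, ∀ u ∈ S.derived v, ∃ b : B, S.Represents E b u ∧ ‖b‖ ≤ M

/-- `‖v‖`, the supremum of the norms in `B` of the functions derived from `v`. -/
noncomputable def exNorm (v : X → ℝ) : ℝ :=
  sSup {r : ℝ | ∃ u ∈ S.derived v, ∃ b : B, S.Represents E b u ∧ r = ‖b‖}

/-- `|ρ_{v,w}(n)| ≤ C ‖v‖ |w|_∞ a n` for all `n ≥ 1`, with `C` the same for all exchangeable
`v ∈ L¹(X)` and all `w ∈ L^∞(X)`. -/
def CorrDominated (a : ℕ → ℝ) : Prop :=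
  ∃ C : ℝ, ∀ v w : X → ℝ, Integrable v S.μX → S.Exchangeable E v → MemLp w ⊤ S.μX →
    ∀ n : ℕ, 1 ≤ n →
      |S.corr v w n| ≤ C * S.exNorm E v * (eLpNorm w ⊤ S.μX).toReal * a n

end InducingScheme

/-! The proof is operator renewal theory with every series cut at degree `n` and a contour whose
radius depends on `n`.

Lift to the tower and count levels from the top. A point `k` levels below the top has returned to
`Y` at time `k + 1`, so up to an error `∑_{j ≥ n} μ(φ > j)` the integral of `v (w ∘ T^n)` is `∑_{k <
n} W_{n-1-k}(b_k)`. Here `W_m b = ∫ b (w ∘ T^m) dμ`, and `b_k ∈ B` comes from a function derived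
from `v`, with norm `O(μ(φ > k))` (`exists_decomposition`). The functionals satisfy `W(z) (1 - R(z))
= A(z)`, where `A_m` integrates over `{φ > m}` only (`exists_renewal_functionals`). The sum is thus
a coefficient of `A(z) (1 - R(z))⁻¹ b(z)`.

With `Z_j = ∑_{k > j} R_k` and `V(z) = ∑ z^j Z_j` one has `1 - R(z) = 1 - R(1) + (1 - z) V(z)`. The
factor `P + (1 - z) (1 - P)`, where `P b = (∫ b dμ) 1`, isolates the simple pole at `1` and leaves
an operator `K(z)` invertible on the whole closed unit disc. The series need not converge beyond
that disc, but the coefficient of `z^n` does not see terms of higher degree, so polynomial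
truncations may replace them.

The radius is `ρ_n = exp(h(n) / n)`, `h(k) = g(k) - (1 + η') log k`. As `h(k) / k` decreases, `μ(φ >
j) ρ_n^j ≪ j^{-(1+η')}` for large `j ≤ n`. The truncated `K` therefore stays invertible, with
bounded inverse, on the disc of radius `ρ_n` (`exists_radii`, `exists_uniform_norm_inverse_le`). The
contour integral is at most `ρ_n^{-n} = n^{1+η'} e^{-g(n)}` times a small power of `n` due to the
pole (`norm_renewal_sub_residue_le`). The residue at `1` is the product of the means up to another
tail sum (`abs_corr_le`). -/

/-! ### Complex-analytic tools: coefficient extraction and a singular integral -/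

/-- A product of two truncated power series, split at degree `n`. -/
theorem exists_truncated_mul {E : Type*} [NormedAddCommGroup E] [NormedSpace ℂ E]
    (n : ℕ) (c : ℕ → ℕ → E) :
    ∃ e : ℂ → E, Differentiable ℂ e ∧ ∀ z : ℂ,
      ∑ i ∈ Finset.range (n + 1), ∑ j ∈ Finset.range (n + 1), z ^ (i + j) • c i j =
        ∑ m ∈ Finset.range (n + 1), z ^ m • ∑ p ∈ Finset.HasAntidiagonal.antidiagonal m, c p.1 p.2 +
          z ^ (n + 1) • e z := by
  classical
  set s := Finset.range (n + 1) ×ˢ Finset.range (n + 1) with hs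
  -- The remainder collects the terms of degree at least `n + 1`, on which the natural subtraction
  -- of exponents is exact.
  refine ⟨fun z => ∑ p ∈ s.filter (fun p => ¬ p.1 + p.2 < n + 1),
    z ^ (p.1 + p.2 - (n + 1)) • c p.1 p.2, by fun_prop, fun z => ?_⟩
  rw [← Finset.sum_product', ← Finset.sum_filter_add_sum_filter_not _
    (fun p : ℕ × ℕ => p.1 + p.2 < n + 1)]
  congr 1
  · rw [← Finset.sum_fiberwise_of_maps_to (g := fun p : ℕ × ℕ => p.1 + p.2)
      (t := Finset.range (n + 1)) (fun p hp => by
        simp only [Finset.mem_filter] at hp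
        simpa using hp.2)]
    refine Finset.sum_congr rfl fun m hm => ?_
    rw [Finset.smul_sum]
    -- For `m ≤ n` the square contains the whole antidiagonal, so no term of the Cauchy product is
    -- lost.
    have : Finset.filter (fun p : ℕ × ℕ => p.1 + p.2 = m)
        (s.filter fun p => p.1 + p.2 < n + 1) = Finset.HasAntidiagonal.antidiagonal m := by
      ext p
      simp only [hs, Finset.mem_filter, Finset.mem_product, Finset.mem_range,
        Finset.HasAntidiagonal.mem_antidiagonal] at hm ⊢
      omega
    rw [this]
    refine Finset.sum_congr rfl fun p hp => ?_
    rw [Finset.HasAntidiagonal.mem_antidiagonal.1 hp]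
  · rw [Finset.smul_sum]
    refine Finset.sum_congr rfl fun p hp => ?_
    rw [smul_smul, ← pow_add]
    congr 2
    simp only [Finset.mem_filter] at hp
    omega

/-- `∮ z ^ m / z ^ (n + 1)` picks out `m = n`. -/
theorem circleIntegral_truncated_coeff {r : ℝ} (hr : 0 < r) (n : ℕ) (f : ℕ → ℂ) :
    ∮ z in C(0, r), (∑ m ∈ Finset.range (n + 1), z ^ m • f m) / z ^ (n + 1) =
      2 * Real.pi * Complex.I * f n := by
  have hz : ∀ z ∈ Metric.sphere (0 : ℂ) r, z ≠ 0 := fun z hz h => by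
    simp [h] at hz; exact hr.ne hz
  have h1 : ∮ z in C(0, r), (∑ m ∈ Finset.range (n + 1), z ^ m • f m) / z ^ (n + 1) =
      ∮ z in C(0, r), ∑ m ∈ Finset.range (n + 1), f m * (z - 0) ^ ((m : ℤ) - (n + 1)) := by
    refine circleIntegral.integral_congr hr.le fun z hzr => ?_
    have := hz z hzr
    simp only [Finset.sum_div, sub_zero, smul_eq_mul]
    refine Finset.sum_congr rfl fun m _ => ?_
    rw [zpow_sub₀ this, zpow_natCast]
    norm_cast
    ring
  rw [h1, circleIntegral.integral_fun_sum]
  · rw [Finset.sum_eq_single_of_mem n (by simp)]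
    · rw [circleIntegral.integral_const_mul]
      have : ((n : ℤ) - (n + 1)) = -1 := by ring
      simp only [this, zpow_neg_one]
      rw [circleIntegral.integral_sub_inv_of_mem_ball (by simpa using hr)]
      ring
    · intro m _ hm
      rw [circleIntegral.integral_const_mul, circleIntegral.integral_sub_zpow_of_ne, mul_zero]
      omega
  · intro m _
    refine ContinuousOn.circleIntegrable hr.le ?_
    refine ContinuousOn.mul continuousOn_const ?_
    intro z hzr
    refine ContinuousAt.continuousWithinAt ?_
    have := hz z hzr
    exact ContinuousAt.zpow₀ (by fun_prop) _ (Or.inl (by simpa using this))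

/-- The singular integral of `1 / |1 - z|` over a circle slightly larger than the unit circle. -/
theorem exists_integral_inv_norm_one_sub_le {ε : ℝ} (hε : 0 < ε) (hε1 : ε < 1) :
    ∃ C : ℝ, 0 ≤ C ∧ ∀ r : ℝ, 1 < r →
      ∫ θ in (0 : ℝ)..2 * Real.pi, ‖1 - circleMap 0 r θ‖⁻¹ ≤ C * (r - 1) ^ (-ε) := by
  have hpi := Real.pi_pos
  -- With `q = |1 - z|`, split `q⁻¹ = q ^ (ε - 1) * q ^ (-ε)`. The second factor is controlled by `q
  -- ≥ r - 1`; the first by `q ≥ |sin (θ / 2)|`, which dominates `θ / π` or `(2π - θ) / π`, and `ε -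
  -- 1 > -1` is integrable.
  set G : ℝ → ℝ := fun θ => (θ / Real.pi) ^ (ε - 1) + ((2 * Real.pi - θ) / Real.pi) ^ (ε - 1)
  have hG1 : IntervalIntegrable (fun θ : ℝ => θ ^ (ε - 1)) volume 0 (2 * Real.pi) :=
    intervalIntegral.intervalIntegrable_rpow' (by linarith)
  have hG2 : IntervalIntegrable (fun θ : ℝ => (2 * Real.pi - θ) ^ (ε - 1)) volume 0
      (2 * Real.pi) := by
    have := (hG1.comp_sub_left (2 * Real.pi)).symm
    simpa using this
  have hGi : IntervalIntegrable G volume 0 (2 * Real.pi) := by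
    have := (hG1.mul_const (Real.pi ^ (ε - 1))⁻¹).add (hG2.mul_const (Real.pi ^ (ε - 1))⁻¹)
    refine this.congr ?_
    intro θ hθ
    rw [uIoc_of_le (by positivity)] at hθ
    simp only [G]
    rw [Real.div_rpow hθ.1.le hpi.le, Real.div_rpow (by linarith [hθ.2]) hpi.le]
    simp [div_eq_mul_inv]
  have hGnn : ∀ θ ∈ Icc (0 : ℝ) (2 * Real.pi), 0 ≤ G θ := fun θ hθ => by
    have : 0 ≤ 2 * Real.pi - θ := by linarith [hθ.2]
    have := hθ.1
    positivity
  refine ⟨∫ θ in (0 : ℝ)..2 * Real.pi, G θ,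
    intervalIntegral.integral_nonneg (by positivity) hGnn, fun r hr => ?_⟩
  rw [← intervalIntegral.integral_mul_const]
  have hne : ∀ θ : ℝ, r - 1 ≤ ‖1 - circleMap 0 r θ‖ := fun θ => by
    have := norm_sub_norm_le (circleMap 0 r θ) 1
    rw [norm_sub_rev] at this
    simpa [abs_of_pos (zero_lt_one.trans hr)] using this
  refine intervalIntegral.integral_mono_on_of_le_Ioo (by positivity) ?_ (hGi.mul_const _) ?_
  · refine ContinuousOn.intervalIntegrable ?_
    refine ContinuousOn.inv₀ (by fun_prop) fun θ _ => ?_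
    exact ((sub_pos.2 hr).trans_le (hne θ)).ne'
  · intro θ hθ
    have hr1 : 0 < r - 1 := sub_pos.2 hr
    set q := ‖1 - circleMap 0 r θ‖ with hq
    have hq0 : 0 < q := hr1.trans_le (hne θ)
    -- lower bound by the sine of the half angle
    have hsin : |Real.sin (θ / 2)| ≤ q := by
      have h1 : q ^ 2 = (r - 1) ^ 2 + 4 * r * Real.sin (θ / 2) ^ 2 := by
        have e : circleMap 0 r θ = ⟨r * Real.cos θ, r * Real.sin θ⟩ := by
          apply Complex.ext <;> simp [circleMap, Complex.exp_re, Complex.exp_im]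
        rw [hq, e, ← Complex.normSq_eq_norm_sq, Complex.normSq_apply]
        have h2 : Real.cos θ = 1 - 2 * Real.sin (θ / 2) ^ 2 := by
          rw [← Real.cos_two_mul_eq_one_sub, mul_div_cancel₀ θ two_ne_zero]
        have h3 := Real.sin_sq_add_cos_sq θ
        simp only [Complex.sub_re, Complex.one_re, Complex.sub_im, Complex.one_im]
        linear_combination r ^ 2 * h3 - 2 * r * h2
      refine abs_le_of_sq_le_sq ?_ hq0.le
      nlinarith [sq_nonneg (r - 1), sq_nonneg (Real.sin (θ / 2))]
    have hlow : ∀ x : ℝ, 0 < x → x / Real.pi ≤ q →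
        q ^ (ε - 1) ≤ (x / Real.pi) ^ (ε - 1) := fun x hx hxq =>
      Real.rpow_le_rpow_of_nonpos (by positivity) hxq (by linarith)
    have hmain : q ^ (ε - 1) ≤ G θ := by
      have p1 : 0 ≤ (θ / Real.pi) ^ (ε - 1) := by have := hθ.1; positivity
      have p2 : 0 ≤ ((2 * Real.pi - θ) / Real.pi) ^ (ε - 1) := by
        have : 0 ≤ 2 * Real.pi - θ := by linarith [hθ.2]
        positivity
      rcases le_total θ Real.pi with h | h
      · have : θ / Real.pi ≤ Real.sin (θ / 2) := by
          have := Real.mul_le_sin (x := θ / 2) (by linarith [hθ.1]) (by linarith)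
          calc θ / Real.pi = 2 / Real.pi * (θ / 2) := by ring
            _ ≤ _ := this
        have := hlow θ hθ.1 (this.trans ((le_abs_self _).trans hsin))
        simp only [G]; linarith
      · have : (2 * Real.pi - θ) / Real.pi ≤ Real.sin (θ / 2) := by
          have := Real.mul_le_sin (x := Real.pi - θ / 2) (by linarith [hθ.2]) (by linarith)
          rw [Real.sin_pi_sub] at this
          calc (2 * Real.pi - θ) / Real.pi = 2 / Real.pi * (Real.pi - θ / 2) := by ring
            _ ≤ _ := this
        have := hlow (2 * Real.pi - θ) (by linarith [hθ.2])
          (this.trans ((le_abs_self _).trans hsin))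
        simp only [G]; linarith
    calc q⁻¹ = q ^ (ε - 1) * q ^ (-ε) := by
          rw [← Real.rpow_add hq0, ← Real.rpow_neg_one]; congr 1; ring
      _ ≤ G θ * (r - 1) ^ (-ε) := by
          refine mul_le_mul hmain ?_ (by positivity) (hGnn θ ⟨hθ.1.le, hθ.2.le⟩)
          exact Real.rpow_le_rpow_of_nonpos hr1 (hne θ) (by linarith)

/-- The truncated power series `∑_{m ≤ n} z ^ m c_m`. -/
noncomputable def truncSeries {E : Type*} [NormedAddCommGroup E] [NormedSpace ℂ E]
    (c : ℕ → E) (n : ℕ) (z : ℂ) : E :=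
  ∑ m ∈ Finset.range (n + 1), z ^ m • c m

theorem differentiable_truncSeries {E : Type*} [NormedAddCommGroup E] [NormedSpace ℂ E]
    (c : ℕ → E) (n : ℕ) : Differentiable ℂ (truncSeries c n) := by
  unfold truncSeries; fun_prop

theorem norm_truncSeries_le {E : Type*} [NormedAddCommGroup E] [NormedSpace ℂ E]
    (c : ℕ → E) (n : ℕ) (z : ℂ) :
    ‖truncSeries c n z‖ ≤ ∑ m ∈ Finset.range (n + 1), ‖z‖ ^ m * ‖c m‖ := by
  refine (norm_sum_le _ _).trans (Finset.sum_le_sum fun m _ => ?_)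
  rw [norm_smul, norm_pow]

/-! ### Operator renewal theory with truncated series -/

section Renewal

variable {B : Type*} [NormedAddCommGroup B] [NormedSpace ℂ B]

/-- `P + (1 - z) (1 - P)`. -/
noncomputable def poleFactor (P : B →L[ℂ] B) (z : ℂ) : B →L[ℂ] B := P + (1 - z) • (1 - P)

/-- The regularization `K` of `1 - R`, `(1 - R(z)) (P + (1 - z) (1 - P)) = (1 - z) K(z)`, where
`V(z) = (R(1) - R(z)) / (1 - z)` and `Z₀ = R(1)`. -/
noncomputable def regularized (Z₀ P V : B →L[ℂ] B) (z : ℂ) : B →L[ℂ] B :=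
  (1 - Z₀) * (1 - P) + V * poleFactor P z

/-- The coefficients of `1 - R(z)`, where `Z j = ∑_{k > j} R_k`. -/
noncomputable def renewalCoeff (Z : ℕ → B →L[ℂ] B) (j : ℕ) : B →L[ℂ] B :=
  if j = 0 then 1 else Z j - Z (j - 1)

/-- As `1 - Z₀` annihilates `P`, a factor `1 - z` comes out of both summands; this factor carries
the whole singularity of the resolvent at `1`. -/
theorem mul_poleFactor {Z₀ P : B →L[ℂ] B} (hP : (1 - Z₀) * P = 0) (V : B →L[ℂ] B) (z : ℂ) :
    (1 - Z₀ + (1 - z) • V) * poleFactor P z = (1 - z) • regularized Z₀ P V z := by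
  have : (1 - Z₀) * poleFactor P z = (1 - z) • ((1 - Z₀) * (1 - P)) := by
    rw [poleFactor, mul_add, hP, zero_add, mul_smul_comm]
  rw [add_mul, this, regularized, smul_add, smul_mul_assoc]

theorem norm_poleFactor_le (P : B →L[ℂ] B) {z : ℂ} (hz : ‖z‖ ≤ 2) :
    ‖poleFactor P z‖ ≤ ‖P‖ + 3 * (1 + ‖P‖) := by
  have h1 : ‖(1 : B →L[ℂ] B) - P‖ ≤ 1 + ‖P‖ :=
    (norm_sub_le _ _).trans (by gcongr; exact ContinuousLinearMap.norm_id_le)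
  have h2 : ‖1 - z‖ ≤ 3 := (norm_sub_le _ _).trans (by rw [norm_one]; linarith)
  refine (norm_add_le _ _).trans ?_
  rw [norm_smul]
  gcongr

/-- Summation by parts. The boundary term has degree `n + 1`, hence is invisible in the coefficient
of `z ^ n`. -/
theorem truncSeries_renewalCoeff (Z : ℕ → B →L[ℂ] B) (n : ℕ) (z : ℂ) :
    truncSeries (renewalCoeff Z) n z =
      1 - Z 0 + (1 - z) • truncSeries Z n z + z ^ (n + 1) • Z n := by
  induction n with
  | zero => simp [truncSeries, renewalCoeff, sub_smul]
  | succ n ih =>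
    simp only [truncSeries] at ih ⊢
    rw [Finset.sum_range_succ, ih, Finset.sum_range_succ (n := n + 1)]
    simp only [renewalCoeff, Nat.add_sub_cancel, if_neg (Nat.succ_ne_zero n)]
    rw [pow_succ' z (n + 1)]
    module

/-- Operator renewal theory with a truncated renewal sequence: the coefficient of `z ^ n` in
`A(z) (1 - R(z))⁻¹ b(z)` is the contribution of the pole at `z = 1` up to a contour integral over a
circle of radius `r > 1`. -/
theorem norm_renewal_sub_residue_le [CompleteSpace B] (n : ℕ) {r : ℝ} (hr : 1 < r) (hr2 : r ≤ 2)
    (Z : ℕ → B →L[ℂ] B) {P : B →L[ℂ] B} (hP : (1 - Z 0) * P = 0) (W A : ℕ → B →L[ℂ] ℂ)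
    (b : ℕ → B)
    (hren : ∀ m ≤ n, ∑ p ∈ Finset.HasAntidiagonal.antidiagonal m,
      (W p.1).comp (renewalCoeff Z p.2) = A m)
    {M α β : ℝ}
    (hK : ∀ z : ℂ, ‖z‖ ≤ r → IsUnit (regularized (Z 0) P (truncSeries Z n z) z) ∧
      ‖Ring.inverse (regularized (Z 0) P (truncSeries Z n z) z)‖ ≤ M)
    (hA : ∀ z : ℂ, ‖z‖ = r → ‖truncSeries A n z‖ ≤ α)
    (hb : ∀ z : ℂ, ‖z‖ = r → ‖truncSeries b n z‖ ≤ β) :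
    ‖∑ p ∈ Finset.HasAntidiagonal.antidiagonal n, W p.1 (b p.2) -
      truncSeries A n 1 (P (Ring.inverse (regularized (Z 0) P (truncSeries Z n 1) 1)
        (truncSeries b n 1)))‖ ≤
      α * ((‖P‖ + 3 * (1 + ‖P‖)) * (M * β)) * (r ^ n)⁻¹ *
        ∫ θ in (0 : ℝ)..2 * Real.pi, ‖1 - circleMap 0 r θ‖⁻¹ := by
  have hr0 : 0 < r := zero_lt_one.trans hr
  set K : ℂ → B →L[ℂ] B := fun z => regularized (Z 0) P (truncSeries Z n z) z with hKdef
  set Q : ℂ → B →L[ℂ] B := fun z => Ring.inverse (K z) with hQdef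
  have hKd : Differentiable ℂ K := by
    have := differentiable_truncSeries Z n
    simp only [hKdef, regularized, poleFactor]
    fun_prop
  have hQd : ∀ z : ℂ, ‖z‖ ≤ r → DifferentiableAt ℂ Q z := fun z hz =>
    DifferentiableAt.comp (g := Ring.inverse) (f := K) z
      (differentiableAt_inverse (𝕜 := ℂ) (hK z hz).1) (hKd z)
  -- the polynomial identity
  obtain ⟨e₁, he₁, hWe⟩ := exists_truncated_mul n
    fun i j => (W i).comp (renewalCoeff Z j)
  obtain ⟨e₂, he₂, hFe⟩ := exists_truncated_mul n fun i j => W i (b j)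
  -- The renewal equation `W(z) (1 - R(z)) = A(z)`, with all truncation errors collected in a
  -- multiple of `z ^ (n + 1)`.
  have hWX : ∀ z, (truncSeries W n z).comp (1 - Z 0 + (1 - z) • truncSeries Z n z) =
      truncSeries A n z + z ^ (n + 1) • (e₁ z - (truncSeries W n z).comp (Z n)) := fun z => by
    have h1 : (truncSeries W n z).comp (truncSeries (renewalCoeff Z) n z) =
        truncSeries A n z + z ^ (n + 1) • e₁ z := by
      have : truncSeries A n z = ∑ m ∈ Finset.range (n + 1), z ^ m •
          ∑ p ∈ Finset.HasAntidiagonal.antidiagonal m, (W p.1).comp (renewalCoeff Z p.2) :=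
        Finset.sum_congr rfl fun m hm => by
          rw [hren m (Nat.lt_succ_iff.1 (Finset.mem_range.1 hm))]
      rw [this, ← hWe z]
      ext x
      simp only [truncSeries, ContinuousLinearMap.comp_apply, sum_apply,
        smul_apply, map_sum, map_smul, Finset.smul_sum]
      refine (Finset.sum_comm).trans (Finset.sum_congr rfl fun i _ =>
        Finset.sum_congr rfl fun j _ => ?_)
      rw [smul_smul, ← pow_add, add_comm]
    rw [truncSeries_renewalCoeff, ContinuousLinearMap.comp_add] at h1
    rw [eq_sub_of_add_eq h1, smul_sub, add_sub_assoc, ContinuousLinearMap.comp_smul]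
  have hWb : ∀ z, truncSeries W n z (truncSeries b n z) =
      truncSeries (fun m => ∑ p ∈ Finset.HasAntidiagonal.antidiagonal m, W p.1 (b p.2)) n z +
        z ^ (n + 1) • e₂ z := fun z => by
    rw [show truncSeries _ n z + _ = _ from (hFe z).symm]
    simp only [truncSeries, sum_apply,
        smul_apply, map_sum, map_smul, Finset.smul_sum]
    refine (Finset.sum_comm).trans (Finset.sum_congr rfl fun i _ =>
        Finset.sum_congr rfl fun j _ => ?_)
    rw [smul_smul, ← pow_add, add_comm]
  -- `y` solves `(1 - Z₀ + (1 - z) V) y = (1 - z) b` for the truncated `V` and `b`; evaluating `hWX`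
  -- at `y` then gives `hmain`.
  set y : ℂ → B := fun z => poleFactor P z (Q z (truncSeries b n z)) with hy
  set Φ : ℂ → ℂ := fun z => truncSeries A n z (y z) with hΦ
  set D : ℂ → ℂ := fun z => e₁ z (y z) - truncSeries W n z (Z n (y z)) with hD
  have hmain : ∀ z : ℂ, ‖z‖ ≤ r →
      (1 - z) * truncSeries W n z (truncSeries b n z) = Φ z + z ^ (n + 1) * D z := fun z hz => by
    have h1 := congrArg (fun L : B →L[ℂ] ℂ => L (y z)) (hWX z)
    have h2 : (1 - Z 0 + (1 - z) • truncSeries Z n z) (y z) =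
        (1 - z) • truncSeries b n z := by
      have h3 := congrArg (fun L : B →L[ℂ] B => L (Q z (truncSeries b n z)))
        (mul_poleFactor hP (truncSeries Z n z) z)
      have h4 := congrArg (fun L : B →L[ℂ] B => L (truncSeries b n z))
        (Ring.mul_inverse_cancel _ (hK z hz).1)
      simp only [mul_apply_eq_comp, smul_apply,
        one_apply_eq_self] at h3 h4
      rw [hy]
      exact h3.trans (congrArg ((1 - z) • ·) h4)
    rw [ContinuousLinearMap.comp_apply, h2, map_smul] at h1
    simpa [hΦ, hD] using h1
  have hyd : ∀ z : ℂ, ‖z‖ ≤ r → DifferentiableAt ℂ y z := fun z hz => by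
    have h1 := hQd z hz
    have h2 := differentiable_truncSeries b n z
    simp only [hy, poleFactor]
    fun_prop
  have hΦd : ∀ z : ℂ, ‖z‖ ≤ r → DifferentiableAt ℂ Φ z := fun z hz => by
    have h1 := hyd z hz
    have h2 := differentiable_truncSeries A n z
    simp only [hΦ]
    fun_prop
  have hDd : ∀ z : ℂ, ‖z‖ ≤ r → DifferentiableAt ℂ D z := fun z hz => by
    have h1 := hyd z hz
    have h2 := differentiable_truncSeries W n z
    have h3 := he₁ z
    simp only [hD]
    fun_prop
  have hsph : ∀ z ∈ Metric.sphere (0 : ℂ) r, ‖z‖ = r ∧ z ≠ 0 ∧ 1 - z ≠ 0 := fun z hz => by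
    have h : ‖z‖ = r := by simpa using hz
    refine ⟨h, fun h0 => ?_, fun h0 => ?_⟩
    · rw [h0, norm_zero] at h; exact hr0.ne h
    · rw [← sub_eq_zero.1 h0, norm_one] at h; exact hr.ne h
  set Fn : ℂ := ∑ p ∈ Finset.HasAntidiagonal.antidiagonal n, W p.1 (b p.2) with hFn
  -- the contour integrals
  have hDint : ∮ z in C(0, r), D z / (1 - z) = 2 * Real.pi * Complex.I * Φ 1 := by
    have h1 : ∮ z in C(0, r), (z - 1)⁻¹ • D z = (2 * Real.pi * Complex.I : ℂ) • D 1 := by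
      refine DiffContOnCl.circleIntegral_sub_inv_smul ?_ (by simpa using hr)
      refine DifferentiableOn.diffContOnCl ?_
      rw [closure_ball _ hr0.ne']
      exact fun z hz => (hDd z (by simpa using hz)).differentiableWithinAt
    -- The left side of `hmain` vanishes at `1`, so the residue of the uncontrolled remainder `D` is
    -- known through `Φ`.
    have h2 : D 1 = -Φ 1 := by
      have := hmain 1 (by simpa using hr.le)
      simp only [sub_self, zero_mul, one_pow, one_mul] at this
      linear_combination -this
    rw [h2] at h1
    have h3 : ∮ z in C(0, r), D z / (1 - z) = ∮ z in C(0, r), (-1 : ℂ) • ((z - 1)⁻¹ • D z) := by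
      refine circleIntegral.integral_congr hr0.le fun z hz => ?_
      rw [smul_eq_mul, smul_eq_mul, ← neg_sub z 1, div_neg, div_eq_inv_mul, neg_one_mul]
    rw [h3, circleIntegral.integral_smul, h1, smul_eq_mul, smul_eq_mul]
    ring
  -- Divide `hmain` by `(1 - z) z ^ (n + 1)` and integrate: the left side yields `Fn`, since the
  -- entire function `e₂` integrates to zero.
  have hkey : 2 * Real.pi * Complex.I * Fn = (∮ z in C(0, r), Φ z / ((1 - z) * z ^ (n + 1))) +
      2 * Real.pi * Complex.I * Φ 1 := by
    have hΦc : CircleIntegrable (fun z => Φ z / ((1 - z) * z ^ (n + 1))) 0 r := by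
      refine ContinuousOn.circleIntegrable hr0.le fun z hz => ?_
      obtain ⟨hz1, hz2, hz3⟩ := hsph z hz
      have := (hΦd z hz1.le).continuousAt
      refine ContinuousAt.continuousWithinAt (ContinuousAt.div this (by fun_prop) ?_)
      exact mul_ne_zero hz3 (pow_ne_zero _ hz2)
    have hDc : CircleIntegrable (fun z => D z / (1 - z)) 0 r := by
      refine ContinuousOn.circleIntegrable hr0.le fun z hz => ?_
      obtain ⟨hz1, hz2, hz3⟩ := hsph z hz
      have := (hDd z hz1.le).continuousAt
      exact ContinuousAt.continuousWithinAt (ContinuousAt.div this (by fun_prop) hz3)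
    have hec : CircleIntegrable e₂ 0 r := he₂.continuous.continuousOn.circleIntegrable hr0.le
    have he0 : ∮ z in C(0, r), e₂ z = 0 :=
      he₂.diffContOnCl.circleIntegral_eq_zero hr0.le
    rw [← hDint, ← circleIntegral.integral_add hΦc hDc, hFn,
      ← circleIntegral_truncated_coeff hr0 n
        fun m => ∑ p ∈ Finset.HasAntidiagonal.antidiagonal m, W p.1 (b p.2)]
    refine Eq.trans ?_ ((circleIntegral.integral_sub (hΦc.add hDc) hec).trans
      (by rw [he0, sub_zero]; rfl))
    refine circleIntegral.integral_congr hr0.le fun z hz => ?_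
    obtain ⟨hz1, hz2, hz3⟩ := hsph z hz
    have h1 := hmain z hz1.le
    rw [hWb z] at h1
    change _ = Φ z / ((1 - z) * z ^ (n + 1)) + D z / (1 - z) - e₂ z
    simp only [truncSeries, smul_eq_mul] at h1 ⊢
    field_simp
    linear_combination h1
  have hdiff : 2 * Real.pi * Complex.I * (Fn - Φ 1) =
      ∮ z in C(0, r), Φ z / ((1 - z) * z ^ (n + 1)) := by
    rw [mul_sub, hkey]; ring
  have hΦ1 : truncSeries A n 1 (P (Ring.inverse (regularized (Z 0) P (truncSeries Z n 1) 1)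
        (truncSeries b n 1))) = Φ 1 := by
    simp [hΦ, hy, poleFactor, hQdef, hKdef]
  rw [hΦ1]
  have hI : ‖∮ z in C(0, r), Φ z / ((1 - z) * z ^ (n + 1))‖ ≤
      α * ((‖P‖ + 3 * (1 + ‖P‖)) * (M * β)) * (r ^ n)⁻¹ *
        ∫ θ in (0 : ℝ)..2 * Real.pi, ‖1 - circleMap 0 r θ‖⁻¹ := by
    rw [circleIntegral, ← intervalIntegral.integral_const_mul]
    have hcont : Continuous fun θ : ℝ => ‖1 - circleMap 0 r θ‖⁻¹ := by
      refine Continuous.inv₀ (by fun_prop) fun θ => norm_ne_zero_iff.2 ?_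
      exact (hsph _ (circleMap_mem_sphere 0 hr0.le θ)).2.2
    refine intervalIntegral.norm_integral_le_of_norm_le Real.two_pi_pos.le
      (ae_of_all _ fun θ _ => ?_) ((continuous_const.mul hcont).intervalIntegrable _ _)
    set z := circleMap 0 r θ with hzdef
    obtain ⟨hz1, hz2, hz3⟩ := hsph z (circleMap_mem_sphere 0 hr0.le θ)
    have hα : 0 ≤ α := (norm_nonneg _).trans (hA z hz1)
    have hM : 0 ≤ M := (norm_nonneg _).trans (hK z hz1.le).2
    have hΦz : ‖Φ z‖ ≤ α * ((‖P‖ + 3 * (1 + ‖P‖)) * (M * β)) := by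
      refine (ContinuousLinearMap.le_opNorm _ _).trans ?_
      refine mul_le_mul (hA z hz1) ?_ (norm_nonneg _) hα
      refine (ContinuousLinearMap.le_opNorm _ _).trans ?_
      refine mul_le_mul (norm_poleFactor_le P (hz1.le.trans hr2)) ?_ (norm_nonneg _) (by positivity)
      refine (ContinuousLinearMap.le_opNorm _ _).trans ?_
      exact mul_le_mul (hK z hz1.le).2 (hb z hz1) (norm_nonneg _) hM
    have hrn : 0 < r ^ n := by positivity
    have hz3' : 0 < ‖1 - z‖ := norm_pos_iff.2 hz3
    calc ‖deriv (circleMap 0 r) θ • (Φ z / ((1 - z) * z ^ (n + 1)))‖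
        = ‖Φ z‖ * (r ^ n)⁻¹ * ‖1 - z‖⁻¹ := by
          rw [deriv_circleMap, ← hzdef, norm_smul, norm_mul, norm_div, norm_mul, norm_pow, hz1,
            Complex.norm_I, pow_succ]
          field_simp
      _ ≤ _ := by gcongr
  have hpi : 1 ≤ ‖(2 * Real.pi * Complex.I : ℂ)‖ := by
    have := Real.pi_gt_three
    simp [abs_of_pos Real.pi_pos]
    linarith
  calc ‖Fn - Φ 1‖ ≤ ‖(2 * Real.pi * Complex.I : ℂ)‖ * ‖Fn - Φ 1‖ :=
        le_mul_of_one_le_left (norm_nonneg _) hpi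
    _ = _ := by rw [← norm_mul, hdiff]
    _ ≤ _ := hI

end Renewal

/-! ### Invertibility of the regularized operators -/

/-- Elements close to a unit are units, with a bound on the inverse. -/
theorem isUnit_and_norm_inverse_le_of_near {A : Type*} [NormedRing A] [CompleteSpace A]
    {u y : A} (hu : IsUnit u) {M : ℝ} (hM : ‖Ring.inverse u‖ ≤ M)
    (h : M * ‖y - u‖ ≤ 1 / 2) : IsUnit y ∧ ‖Ring.inverse y‖ ≤ 2 * M := by
  obtain ⟨u, rfl⟩ := hu
  rw [Ring.inverse_unit] at hM
  have h1 : ‖(↑u⁻¹ : A) * ((u : A) - y)‖ < 1 := by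
    refine ((norm_mul_le _ _).trans ?_).trans_lt one_half_lt_one
    rw [norm_sub_rev]
    exact (mul_le_mul_of_nonneg_right hM (norm_nonneg _)).trans h
  have h2 : y = u * (1 - (↑u⁻¹ : A) * ((u : A) - y)) := by
    rw [mul_sub, mul_one, Units.mul_inv_cancel_left, sub_sub_cancel]
  have hy : IsUnit y := by
    rw [h2]
    exact u.isUnit.mul (isUnit_one_sub_of_norm_lt_one h1)
  refine ⟨hy, ?_⟩
  obtain ⟨y, rfl⟩ := hy
  rw [Ring.inverse_unit]
  -- The resolvent identity gives `‖y⁻¹‖ ≤ M + ‖y⁻¹‖ / 2`.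
  have h3 : (↑y⁻¹ : A) = ↑u⁻¹ - ↑u⁻¹ * ((y : A) - u) * ↑y⁻¹ := by
    rw [mul_sub, Units.inv_mul, sub_mul, one_mul, mul_assoc, Units.mul_inv, mul_one]
    abel
  have h4 : ‖(↑u⁻¹ : A) * ((y : A) - u) * ↑y⁻¹‖ ≤ 1 / 2 * ‖(↑y⁻¹ : A)‖ := by
    refine (norm_mul_le _ _).trans (mul_le_mul_of_nonneg_right ?_ (norm_nonneg _))
    exact (norm_mul_le _ _).trans ((mul_le_mul_of_nonneg_right hM (norm_nonneg _)).trans h)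
  have h5 := norm_sub_le (↑u⁻¹ : A) (↑u⁻¹ * ((y : A) - u) * ↑y⁻¹)
  rw [← h3] at h5
  linarith

section Renewal

variable {B : Type*} [NormedAddCommGroup B] [NormedSpace ℂ B]

/-- Away from `1` the pole factor is itself invertible, with inverse `P + (1 - z)⁻¹ (1 - P)`,
because `P` is a projection. -/
theorem isUnit_regularized_of_ne_one {Z₀ P V : B →L[ℂ] B} (hP : (1 - Z₀) * P = 0)
    (hPP : P * P = P) {z : ℂ} (hz : z ≠ 1) (h : IsUnit (1 - Z₀ + (1 - z) • V)) :
    IsUnit (regularized Z₀ P V z) := by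
  have hz' : 1 - z ≠ 0 := sub_ne_zero.2 hz.symm
  have hN : IsUnit (poleFactor P z) := by
    have h1 : ∀ a b : ℂ, a * b = 1 →
        (P + a • (1 - P)) * (P + b • (1 - P)) = 1 := fun a b hab => by
      have h2 : (P + a • (1 - P)) * (P + b • (1 - P)) = P + (a * b) • (1 - P) := by
        simp only [add_mul, mul_add, smul_mul_assoc, mul_smul_comm, mul_sub, sub_mul, hPP, mul_one,
          one_mul]
        module
      rw [h2, hab, one_smul, add_sub_cancel]
    exact ⟨⟨_, P + (1 - z)⁻¹ • (1 - P), h1 _ _ (mul_inv_cancel₀ hz'),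
      h1 _ _ (inv_mul_cancel₀ hz')⟩, rfl⟩
  have h2 := h.mul hN
  rw [mul_poleFactor hP] at h2
  have h3 : regularized Z₀ P V z = (Units.mk0 _ hz')⁻¹ • ((1 - z) • regularized Z₀ P V z) := by
    rw [Units.smul_def, smul_smul]; simp [hz']
  rw [h3]
  exact h2.smul _

/-- At `1` the operator is `x ↦ (x - Z₀ x) + ι x • V e`, and `ι` kills the range of `1 - Z₀`. If the
image vanishes, `ι (V e) ≠ 0` forces `ι x = 0`, so `x` is a multiple of `e` with zero integral. For
surjectivity, a multiple of `V e` moves the target into `ker ι`; simplicity of the eigenvalue places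
it in the range of `1 - Z₀`. -/
theorem isUnit_regularized_one [CompleteSpace B] {Z₀ V : B →L[ℂ] B} (ι : B →L[ℂ] ℂ) {e : B}
    (hιe : ι e = 1) (hZe : Z₀ e = e) (hιZ : ∀ x, ι (Z₀ x) = ι x) (hV : ι (V e) ≠ 0)
    (hsimple : IsSimpleIsolatedEigenvalue Z₀ 1) :
    IsUnit (regularized Z₀ (ι.smulRight e) V 1) := by
  obtain ⟨-, hdim, hcompl⟩ := hsimple
  have he : e ≠ 0 := fun h => by simp [h] at hιe
  have hK : ∀ x, regularized Z₀ (ι.smulRight e) V 1 x = (x - Z₀ x) + ι x • V e := fun x => by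
    simp [regularized, poleFactor, hZe]
  have hmem : ∀ x, x ∈ LinearMap.ker ((Z₀ - (1 : ℂ) • (1 : B →L[ℂ] B) : B →L[ℂ] B) : B →ₗ[ℂ] B) ↔
      Z₀ x = x := fun x => by
    simp [sub_eq_zero]
  have hker : ∀ x, Z₀ x = x → ∃ c : ℂ, c • e = x := fun x hx => by
    obtain ⟨c, hc⟩ := exists_smul_eq_of_finrank_eq_one hdim
      (x := ⟨e, (hmem e).2 hZe⟩) (fun h => he (congrArg Subtype.val h)) ⟨x, (hmem x).2 hx⟩
    exact ⟨c, congrArg Subtype.val hc⟩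
  rw [ContinuousLinearMap.isUnit_iff_bijective]
  constructor
  · refine (injective_iff_map_eq_zero _).2 fun x hx => ?_
    rw [hK] at hx
    have h1 : ι x = 0 := by
      have := congrArg ι hx
      simpa [hιZ, hV] using this
    rw [h1, zero_smul, add_zero, sub_eq_zero] at hx
    obtain ⟨c, rfl⟩ := hker x hx.symm
    have : c = 0 := by simpa [hιe] using h1
    rw [this, zero_smul]
  · intro y
    set a := ι y / ι (V e)
    have hy0 : ι (y - a • V e) = 0 := by simp [a, hV]
    obtain ⟨k, hk, ρ, hρ, hkρ⟩ := Submodule.mem_sup.1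
      ((hcompl.sup_eq_top ▸ Submodule.mem_top : (y - a • V e) ∈ _))
    obtain ⟨x, hx⟩ := hρ
    have hx' : Z₀ x - x = ρ := by simpa using hx
    obtain ⟨c, hc⟩ := hker k ((hmem k).1 hk)
    have hc0 : c = 0 := by
      have := congrArg ι hkρ
      rw [hy0, ← hc, ← hx'] at this
      simpa [hιZ, hιe] using this
    rw [hc0, zero_smul] at hc
    rw [← hc, zero_add, ← hx'] at hkρ
    -- The multiple of `e` does not affect `x - Z₀ x`; it is chosen to make `ι` of the witness equal
    -- to `a`.
    refine ⟨-x + (a + ι x) • e, ?_⟩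
    rw [hK]
    simp only [map_add, map_neg, map_smul, hZe, hιe, smul_eq_mul, mul_one]
    have : y = Z₀ x - x + a • V e := by rw [hkρ]; abel
    rw [this]
    module

/-- Invertibility of the regularized operators on the closed unit disc persists, uniformly, for the
truncations on slightly larger discs. -/
theorem exists_uniform_norm_inverse_le [CompleteSpace B] {Z : ℕ → B →L[ℂ] B} {P : B →L[ℂ] B}
    (hZ : Summable fun j => ‖Z j‖)
    (hK : ∀ z : ℂ, ‖z‖ ≤ 1 → IsUnit (regularized (Z 0) P (∑' j, z ^ j • Z j) z))
    {ρ : ℕ → ℝ} (hρ1 : ∀ᶠ n in atTop, 1 ≤ ρ n) (hρ : Tendsto ρ atTop (nhds 1)) {bound : ℕ → ℝ}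
    (hbound : Summable bound)
    (hle : ∀ᶠ n in atTop, ∀ j ≤ n, ‖Z j‖ * ρ n ^ j ≤ bound j) :
    ∃ M : ℝ, ∀ᶠ n in atTop, ∀ z : ℂ, ‖z‖ ≤ ρ n →
      IsUnit (regularized (Z 0) P (truncSeries Z n z) z) ∧
        ‖Ring.inverse (regularized (Z 0) P (truncSeries Z n z) z)‖ ≤ M := by
  set V : ℂ → B →L[ℂ] B := fun z => ∑' j, z ^ j • Z j with hVdef
  have hterm : ∀ z : ℂ, ‖z‖ ≤ 1 → ∀ j, ‖z ^ j • Z j‖ ≤ ‖Z j‖ := fun z hz j => by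
    rw [norm_smul, norm_pow]
    exact mul_le_of_le_one_left (norm_nonneg _) (pow_le_one₀ (norm_nonneg _) hz)
  have hVc : ContinuousOn V (Metric.closedBall 0 1) :=
    continuousOn_tsum (fun j => by fun_prop) hZ fun j z hz => hterm z (by simpa using hz) j
  have hVn : ∀ z : ℂ, ‖z‖ ≤ 1 → ‖V z‖ ≤ ∑' j, ‖Z j‖ := fun z hz =>
    tsum_of_norm_bounded hZ.hasSum (hterm z hz)
  -- a bound on the closed unit disc
  obtain ⟨M₀, hM₀⟩ := (isCompact_closedBall (0 : ℂ) 1).exists_bound_of_continuousOn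
    (f := fun z => Ring.inverse (regularized (Z 0) P (V z) z)) (by
      intro z hz
      have hz1 : ‖z‖ ≤ 1 := by simpa using hz
      have h1 : ContinuousWithinAt (fun z => regularized (Z 0) P (V z) z)
          (Metric.closedBall 0 1) z := by
        have := hVc z hz
        simp only [regularized, poleFactor]
        fun_prop
      obtain ⟨u, hu⟩ := hK z hz1
      have h2 : ContinuousAt Ring.inverse (regularized (Z 0) P (V z) z) := by
        rw [← hu]; exact NormedRing.inverse_continuousAt u
      exact ContinuousAt.comp_continuousWithinAt (f := fun z => regularized (Z 0) P (V z) z) h2 h1)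
  set M := max M₀ 1
  have hM : 0 < M := lt_max_of_lt_right one_pos
  -- the distance to the truncation
  set f : ℕ → ℕ → ℝ := fun n j => if j ≤ n then ‖Z j‖ * (ρ n ^ j - 1) else ‖Z j‖ with hf
  -- Dominated convergence in `j`: each term tends to zero as `ρ n → 1`, and `hle` supplies the
  -- summable majorant.
  have hd : Tendsto (fun n => ∑' j, f n j) atTop (nhds 0) := by
    have h0 : ∑' _ : ℕ, (0 : ℝ) = 0 := tsum_zero
    rw [← h0]
    refine tendsto_tsum_of_dominated_convergence (bound := fun j => |bound j| + ‖Z j‖)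
      (hbound.abs.add hZ) (fun j => ?_) ?_
    · have h1 : Tendsto (fun n => ‖Z j‖ * (ρ n ^ j - 1)) atTop (nhds (‖Z j‖ * (1 ^ j - 1))) :=
        ((hρ.pow j).sub_const 1).const_mul _
      rw [one_pow, sub_self, mul_zero] at h1
      refine h1.congr' ?_
      filter_upwards [eventually_ge_atTop j] with n hn
      simp [hf, hn]
    · filter_upwards [hle, hρ1] with n hn hn1 j
      have hb : 0 ≤ ‖Z j‖ := norm_nonneg _
      by_cases hj : j ≤ n
      · have h1 : 1 ≤ ρ n ^ j := one_le_pow₀ hn1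
        have h2 := hn j hj
        simp only [hf, if_pos hj]
        rw [Real.norm_of_nonneg (mul_nonneg hb (by linarith))]
        have := le_abs_self (bound j)
        linarith [mul_sub ‖Z j‖ (ρ n ^ j) 1]
      · simp only [hf, if_neg hj, norm_norm]
        exact le_add_of_nonneg_left (abs_nonneg _)
  set S := ∑' j, ‖Z j‖
  have hlim : Tendsto (fun n => M * ((∑' j, f n j) * (‖P‖ + 3 * (1 + ‖P‖)) +
      S * ((ρ n - 1) * (1 + ‖P‖)))) atTop (nhds 0) := by
    have := ((hd.mul_const (‖P‖ + 3 * (1 + ‖P‖))).add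
      (((hρ.sub_const 1).mul_const (1 + ‖P‖)).const_mul S)).const_mul M
    simpa using this
  refine ⟨2 * M, ?_⟩
  filter_upwards [hρ1, hρ.eventually_le_const one_lt_two,
    hlim.eventually_le_const one_half_pos] with n hn1 hn2 hn z hz
  have hmax : 0 < max 1 ‖z‖ := lt_max_of_lt_left one_pos
  set t : ℝ := max 1 ‖z‖ with ht
  -- `w` is the radial projection of `z` to the closed unit disc, where the full series `V`
  -- converges and the inverse is bounded by `M`.
  set w : ℂ := z / t with hw
  have htz : z = t * w := by
    rw [hw, mul_div_cancel₀]
    exact_mod_cast hmax.ne'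
  have ht1 : 1 ≤ t := le_max_left _ _
  have htρ : t ≤ ρ n := max_le hn1 hz
  have hw1 : ‖w‖ ≤ 1 := by
    rw [hw, norm_div, Complex.norm_real, Real.norm_of_nonneg hmax.le]
    exact div_le_one_of_le₀ (le_max_right _ _) hmax.le
  have hpow : ∀ j, ‖z ^ j - w ^ j‖ ≤ ρ n ^ j - 1 := fun j => by
    have h1 : z ^ j - w ^ j = ((t ^ j - 1 : ℝ) : ℂ) * w ^ j := by
      rw [htz]; push_cast; ring
    have h2 : 1 ≤ t ^ j := one_le_pow₀ ht1
    rw [h1, norm_mul, Complex.norm_real, norm_pow, Real.norm_of_nonneg (by linarith)]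
    refine (mul_le_of_le_one_right (by linarith) (pow_le_one₀ (norm_nonneg _) hw1)).trans ?_
    gcongr
  have hVdiff : ‖truncSeries Z n z - V w‖ ≤ ∑' j, f n j := by
    have h1 : HasSum (fun j => (if j ≤ n then z ^ j • Z j else 0) - w ^ j • Z j)
        (truncSeries Z n z - V w) := by
      refine HasSum.sub ?_ (Summable.of_norm_bounded hZ (hterm w hw1)).hasSum
      have : truncSeries Z n z = ∑ j ∈ Finset.range (n + 1),
          (if j ≤ n then z ^ j • Z j else 0) :=
        Finset.sum_congr rfl fun j hj => by
          rw [if_pos (Nat.lt_succ_iff.1 (Finset.mem_range.1 hj))]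
      rw [this]
      refine hasSum_sum_of_ne_finset_zero fun j hj => if_neg fun h => hj ?_
      exact Finset.mem_range.2 (Nat.lt_succ_iff.2 h)
    have hfs : Summable (f n) := by
      refine hZ.of_norm_bounded_eventually_nat ?_
      filter_upwards [eventually_gt_atTop n] with j hj
      simp [hf, not_le.2 hj]
    rw [← h1.tsum_eq]
    refine tsum_of_norm_bounded hfs.hasSum fun j => ?_
    by_cases hj : j ≤ n
    · simp only [hf, if_pos hj]
      rw [← sub_smul, norm_smul, mul_comm]
      exact mul_le_mul_of_nonneg_left (hpow j) (norm_nonneg _)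
    · simp only [hf, if_neg hj, zero_sub, norm_neg]
      exact hterm w hw1 j
  have hNdiff : ‖poleFactor P z - poleFactor P w‖ ≤ (ρ n - 1) * (1 + ‖P‖) := by
    have h1 : poleFactor P z - poleFactor P w = (w - z) • (1 - P) := by
      simp only [poleFactor]; module
    have h2 : ‖w - z‖ ≤ ρ n - 1 := by
      rw [norm_sub_rev]; simpa using hpow 1
    have h3 : ‖(1 : B →L[ℂ] B) - P‖ ≤ 1 + ‖P‖ :=
      (norm_sub_le _ _).trans (by gcongr; exact ContinuousLinearMap.norm_id_le)
    rw [h1, norm_smul]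
    have : 0 ≤ ρ n - 1 := by linarith
    gcongr
  refine isUnit_and_norm_inverse_le_of_near (hK w hw1)
    ((hM₀ w (by simpa using hw1)).trans (le_max_left _ _)) (le_trans ?_ hn)
  refine mul_le_mul_of_nonneg_left ?_ hM.le
  have h1 : regularized (Z 0) P (truncSeries Z n z) z - regularized (Z 0) P (V w) w =
      (truncSeries Z n z - V w) * poleFactor P z + V w * (poleFactor P z - poleFactor P w) := by
    simp only [regularized]; noncomm_ring
  rw [h1]
  refine (norm_add_le _ _).trans (add_le_add ?_ ?_)
  · refine (norm_mul_le _ _).trans ?_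
    exact mul_le_mul hVdiff (norm_poleFactor_le P (hz.trans hn2)) (norm_nonneg _)
      ((norm_nonneg _).trans hVdiff)
  · refine (norm_mul_le _ _).trans ?_
    exact mul_le_mul (hVn w hw1) hNdiff (norm_nonneg _) ((norm_nonneg _).trans (hVn w hw1))

end Renewal

/-! ### Choice of the radii -/

theorem tendsto_log_natCast_div_self :
    Tendsto (fun n : ℕ => Real.log n / n) atTop (nhds 0) := by
  have := (Real.tendsto_pow_log_div_mul_add_atTop 1 0 1 one_ne_zero).comp
    tendsto_natCast_atTop_atTop
  simpa [Function.comp_def] using this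

/-- If `(g k - a log k) / k` is eventually decreasing and `g` is increasing, then
`g k ≥ a log k` eventually. -/
theorem mul_log_le_of_antitoneOn {g : ℕ → ℝ} (hg : MonotoneOn g (Ici 1)) {a : ℝ} {k₀ : ℕ}
    (hanti : AntitoneOn (fun k : ℕ => (g k - a * Real.log k) / k) (Ici k₀)) {k : ℕ}
    (hk : k₀ ≤ k) (hk1 : 1 ≤ k) : a * Real.log k ≤ g k := by
  have hk0 : (0 : ℝ) < k := by exact_mod_cast hk1
  have hlim : Tendsto (fun m : ℕ => g 1 / m - a * (Real.log m / m)) atTop (nhds 0) := by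
    have := (tendsto_const_div_atTop_nhds_zero_nat (g 1)).sub
      (tendsto_log_natCast_div_self.const_mul a)
    simpa using this
  -- By antitonicity the value at `k` is at least every later value, and these are bounded below by
  -- a sequence tending to zero since `g m ≥ g 1`.
  have h : 0 ≤ (g k - a * Real.log k) / k := by
    refine le_of_tendsto hlim ?_
    filter_upwards [eventually_ge_atTop k] with m hm
    refine le_trans ?_ (hanti hk (hk.trans hm) hm)
    have hm0 : (0 : ℝ) < m := hk0.trans_le (by exact_mod_cast hm)
    have := hg (mem_Ici.2 le_rfl) (mem_Ici.2 (hk1.trans hm)) (hk1.trans hm)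
    simp only [sub_div, mul_div_assoc]
    gcongr
  have := (div_nonneg_iff.1 h).resolve_right fun h' => absurd h'.2 (not_le.2 hk0)
  linarith [this.1]

/-- The logarithmic lower bound on `g` gives `exp (-g k) ≤ k ^ (-(1 + η))` eventually. -/
theorem summable_exp_neg_of_antitoneOn {g : ℕ → ℝ} (hg : MonotoneOn g (Ici 1)) {η : ℝ}
    (hη : 0 < η) {k₀ : ℕ}
    (hanti : AntitoneOn (fun k : ℕ => (g k - (1 + η) * Real.log k) / k) (Ici k₀)) :
    Summable fun n => Real.exp (-g n) := by
  refine (Real.summable_nat_rpow.2 (show -(1 + η) < -1 by linarith)).of_norm_bounded_eventually_nat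
    ?_
  filter_upwards [eventually_ge_atTop k₀, eventually_ge_atTop 1] with k hk hk1
  have hk0 : (0 : ℝ) < k := by exact_mod_cast hk1
  have := mul_log_le_of_antitoneOn hg hanti hk hk1
  rw [Real.norm_of_nonneg (Real.exp_pos _).le, Real.rpow_def_of_pos hk0]
  exact Real.exp_le_exp.2 (by linarith)

/-- Radii adapted to the decay rate `exp (-g n)`. -/
theorem exists_radii {g : ℕ → ℝ} (hg : MonotoneOn g (Ici 1))
    (hgO : ∃ δ : ℝ, 0 < δ ∧ Dominated g (fun n => (n : ℝ) ^ (1 - δ))) {η : ℝ} (hη : 0 < η)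
    {k₀ : ℕ} (hanti : AntitoneOn (fun k : ℕ => (g k - (1 + η) * Real.log k) / k) (Ici k₀))
    {τ : ℕ → ℝ} (hτ0 : ∀ n, 0 ≤ τ n) (hτ : Dominated τ fun n => Real.exp (-g n)) {ε : ℝ}
    (hε : 0 < ε) :
    ∃ (ρ bound : ℕ → ℝ) (s C : ℝ), Summable bound ∧ 0 < s ∧ s < 1 ∧
      (∀ᶠ n in atTop, 1 < ρ n) ∧ Tendsto ρ atTop (nhds 1) ∧
      (∀ᶠ n in atTop, ∀ j ≤ n, τ j * ρ n ^ j ≤ bound j) ∧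
      ∀ᶠ n : ℕ in atTop, (ρ n ^ n)⁻¹ * (ρ n - 1) ^ (-s) ≤
        C * ((n : ℝ) ^ (1 + ε) * Real.exp (-g n)) := by
  obtain ⟨δ, hδ, K₁, hK₁⟩ := hgO
  obtain ⟨K₂, hK₂⟩ := hτ
  -- The loss `ε` is shared: `η'` pays for summability of `j ^ (-(1 + η'))`, and `s` for the pole.
  -- Taking `η' < η` leaves a surplus `c log k` in `h k`, which keeps `ρ n - 1` at least `c / n`.
  set η' := min (η / 2) (ε / 2) with hη'def
  have hη'0 : 0 < η' := lt_min (by linarith) (by linarith)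
  have hη'η : η' ≤ η / 2 := min_le_left _ _
  have hη'ε : η' ≤ ε / 2 := min_le_right _ _
  set s := min (1 / 2) (ε / 2) with hs
  have hs0 : 0 < s := lt_min (by norm_num) (by linarith)
  have hs1 : s < 1 := (min_le_left _ _).trans_lt (by norm_num)
  have hsε : s ≤ ε / 2 := min_le_right _ _
  set c := η - η' with hc
  have hc0 : 0 < c := by linarith
  set h : ℕ → ℝ := fun k => g k - (1 + η') * Real.log k with hh
  set k₁ := max k₀ 3 with hk₁
  have hlog1 : ∀ k : ℕ, 3 ≤ k → 1 ≤ Real.log k := fun k hk => by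
    rw [Real.le_log_iff_exp_le (by positivity)]
    have : (3 : ℝ) ≤ k := by exact_mod_cast hk
    linarith [Real.exp_one_lt_three]
  -- `h k / k` is the given decreasing sequence plus `c log k / k`; the latter decreases only from
  -- `e` on, hence the `3` in `k₁`.
  have hanti' : AntitoneOn (fun k : ℕ => h k / k) (Ici k₁) := fun i hi j hj hij => by
    have hi' : max k₀ 3 ≤ i := hi
    have hj' : max k₀ 3 ≤ j := hj
    have h1 := hanti (mem_Ici.2 ((le_max_left _ _).trans hi'))
      (mem_Ici.2 ((le_max_left _ _).trans hj')) hij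
    have hex : ∀ k : ℕ, 3 ≤ k → Real.exp 1 ≤ k := fun k hk => by
      have : (3 : ℝ) ≤ k := by exact_mod_cast hk
      linarith [Real.exp_one_lt_three]
    have h2 : Real.log j / j ≤ Real.log i / i :=
      Real.log_div_self_antitoneOn (hex i ((le_max_right _ _).trans hi'))
        (hex j ((le_max_right _ _).trans hj')) (by exact_mod_cast hij)
    have h3 : ∀ k : ℕ, h k / k = (g k - (1 + η) * Real.log k) / k + c * (Real.log k / k) :=
      fun k => by simp only [hh, hc]; ring
    simp only [h3]
    exact add_le_add h1 (mul_le_mul_of_nonneg_left h2 hc0.le)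
  have hlow : ∀ k, k₁ ≤ k → c * Real.log k ≤ h k := fun k hk => by
    have := mul_log_le_of_antitoneOn hg hanti ((le_max_left _ _).trans hk)
      ((by norm_num : 1 ≤ 3).trans ((le_max_right _ _).trans hk))
    simp only [hh, hc]; linarith
  set ρ : ℕ → ℝ := fun n => Real.exp (h n / n) with hρ
  have hbase : ∀ n, k₁ ≤ n → 3 ≤ n ∧ (0 : ℝ) < n ∧ 1 ≤ Real.log n ∧ c ≤ h n := fun n hn => by
    have h3 : 3 ≤ n := (le_max_right _ _).trans hn
    have hl := hlog1 n h3
    refine ⟨h3, by positivity, hl, le_trans ?_ (hlow n hn)⟩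
    exact le_mul_of_one_le_right hc0.le hl
  have hρsub : ∀ n, k₁ ≤ n → c / n ≤ ρ n - 1 := fun n hn => by
    obtain ⟨h3, hn0, hl, hcn⟩ := hbase n hn
    have := Real.add_one_le_exp (h n / n)
    have : c / n ≤ h n / n := by gcongr
    simp only [hρ]; linarith
  have hρ1 : Tendsto ρ atTop (nhds 1) := by
    -- This is where `g(n) = O(n ^ (1 - δ))` enters.
    have h0 : Tendsto (fun n => h n / n) atTop (nhds 0) := by
      refine tendsto_of_tendsto_of_tendsto_of_le_of_le' tendsto_const_nhds
        (h := fun n : ℕ => |K₁| * (n : ℝ) ^ (-δ)) ?_ ?_ ?_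
      · have := ((tendsto_rpow_neg_atTop hδ).comp tendsto_natCast_atTop_atTop).const_mul |K₁|
        simpa [Function.comp_def] using this
      · filter_upwards [eventually_ge_atTop k₁] with n hn
        obtain ⟨h3, hn0, hl, hcn⟩ := hbase n hn
        have := hc0.le.trans hcn
        positivity
      · filter_upwards [eventually_ge_atTop k₁] with n hn
        obtain ⟨h3, hn0, hl, hcn⟩ := hbase n hn
        rw [div_le_iff₀ hn0]
        have h1 := hK₁ n (by omega)
        have h2 : |K₁| * (n : ℝ) ^ (-δ) * n = |K₁| * (n : ℝ) ^ (1 - δ) := by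
          rw [mul_assoc, ← Real.rpow_add_one hn0.ne']; congr 2; ring
        have h4 : K₁ * (n : ℝ) ^ (1 - δ) ≤ |K₁| * (n : ℝ) ^ (1 - δ) := by
          gcongr; exact le_abs_self _
        have h5 : 0 ≤ (1 + η') * Real.log n := by positivity
        rw [h2]
        simp only [hh]; linarith
    have := (Real.continuous_exp.tendsto 0).comp h0
    simpa [Function.comp_def, hρ] using this
  -- The finitely many indices below `k₁`, where monotonicity of `h k / k` is unavailable, are
  -- bounded by means of `ρ n ≤ 2`.
  refine ⟨ρ, fun j => |K₂| * (j : ℝ) ^ (-(1 + η')) +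
    if j ∈ Finset.range k₁ then τ j * 2 ^ j else 0, s, c ^ (-s), ?_, hs0, hs1, ?_, hρ1, ?_, ?_⟩
  · refine ((Real.summable_nat_rpow.2 (by linarith)).mul_left _).add ?_
    exact summable_of_ne_finset_zero (s := Finset.range k₁) fun j hj => if_neg hj
  · filter_upwards [eventually_ge_atTop k₁] with n hn
    obtain ⟨h3, hn0, hl, hcn⟩ := hbase n hn
    have := hρsub n hn
    have : 0 < c / n := by positivity
    linarith
  · filter_upwards [eventually_ge_atTop k₁, hρ1.eventually_le_const one_lt_two] with n hn hn2 j hj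
    have hρ0 : 0 < ρ n := Real.exp_pos _
    by_cases hjk : j < k₁
    · rw [if_pos (Finset.mem_range.2 hjk)]
      have h1 : τ j * ρ n ^ j ≤ τ j * 2 ^ j :=
        mul_le_mul_of_nonneg_left (pow_le_pow_left₀ hρ0.le hn2 j) (hτ0 j)
      have h2 : 0 ≤ |K₂| * (j : ℝ) ^ (-(1 + η')) := by positivity
      linarith
    · rw [if_neg (fun h => hjk (Finset.mem_range.1 h)), add_zero]
      push Not at hjk
      obtain ⟨h3, hj0, hl, hcj⟩ := hbase j hjk
      -- For `k₁ ≤ j ≤ n`, `ρ n ^ j = exp (j h(n) / n) ≤ exp (h j)`; the factor `exp (g j)` cancels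
      -- the decay of `τ j`.
      have h1 : ρ n ^ j ≤ Real.exp (h j) := by
        rw [hρ, ← Real.exp_nat_mul]
        refine Real.exp_le_exp.2 ?_
        have := hanti' (mem_Ici.2 hjk) (mem_Ici.2 hn) hj
        calc (j : ℝ) * (h n / n) ≤ j * (h j / j) := by gcongr
          _ = h j := by field_simp
      have h2 : τ j ≤ |K₂| * Real.exp (-g j) := (hK₂ j (by omega)).trans (by
        gcongr; exact le_abs_self _)
      calc τ j * ρ n ^ j ≤ |K₂| * Real.exp (-g j) * Real.exp (h j) := by gcongr
        _ = |K₂| * (j : ℝ) ^ (-(1 + η')) := by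
          rw [mul_assoc, ← Real.exp_add, Real.rpow_def_of_pos hj0]
          congr 2; simp only [hh]; ring
  · filter_upwards [eventually_ge_atTop k₁] with n hn
    obtain ⟨h3, hn0, hl, hcn⟩ := hbase n hn
    have hn1 : (1 : ℝ) ≤ n := by exact_mod_cast (by omega : 1 ≤ n)
    have h1 : (ρ n ^ n)⁻¹ = (n : ℝ) ^ (1 + η') * Real.exp (-g n) := by
      rw [hρ, ← Real.exp_nat_mul, ← Real.exp_neg, Real.rpow_def_of_pos hn0, ← Real.exp_add]
      congr 1
      rw [mul_div_cancel₀ _ hn0.ne']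
      simp only [hh]; ring
    have h2 : (ρ n - 1) ^ (-s) ≤ c ^ (-s) * (n : ℝ) ^ s := by
      refine (Real.rpow_le_rpow_of_nonpos (by positivity) (hρsub n hn) (by linarith)).trans_eq ?_
      rw [Real.div_rpow hc0.le hn0.le, Real.rpow_neg hn0.le, div_inv_eq_mul]
    calc (ρ n ^ n)⁻¹ * (ρ n - 1) ^ (-s)
        ≤ (n : ℝ) ^ (1 + η') * Real.exp (-g n) * (c ^ (-s) * (n : ℝ) ^ s) := by
          rw [h1]; gcongr
      _ = c ^ (-s) * ((n : ℝ) ^ (1 + η' + s) * Real.exp (-g n)) := by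
          rw [Real.rpow_add hn0 (1 + η') s]; ring
      _ ≤ _ := by
          gcongr 1
          gcongr 1
          exact Real.rpow_le_rpow_of_exponent_le hn1 (by linarith)

/-! ### Integration along the tower -/

namespace InducingScheme

variable {X : Type*} [MeasurableSpace X] (S : InducingScheme X)

instance : IsProbabilityMeasure S.μ := S.isProbabilityMeasure

theorem measurePreserving_F : MeasurePreserving S.F S.μ S.μ := S.ergodic.toMeasurePreserving

theorem measurable_orbit (n : ℕ) : Measurable fun y : S.Y => S.T^[n] (y : X) :=
  (S.measurable_T.iterate n).comp measurable_subtype_coe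

theorem measurableSet_lt_φ (n : ℕ) : MeasurableSet {y | n < S.φ y} :=
  S.measurable_φ (measurableSet_Ioi (a := n))

theorem measurableSet_φ_eq (n : ℕ) : MeasurableSet {y | S.φ y = n} :=
  S.measurable_φ (measurableSet_singleton n)

theorem iterate_eq_iterate_F {m : ℕ} {y : S.Y} (h : S.φ y ≤ m) :
    S.T^[m] (y : X) = S.T^[m - S.φ y] (S.F y : X) := by
  conv_lhs => rw [← Nat.sub_add_cancel h, Function.iterate_add_apply]
  rfl

theorem tail_nonneg (n : ℕ) : 0 ≤ S.tail n := measureReal_nonneg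

theorem tail_zero : S.tail 0 = 1 := by
  have : {y | 0 < S.φ y} = univ := eq_univ_of_forall fun y => S.one_le_φ y
  rw [tail, this, probReal_univ]

/-- The mean return time. -/
noncomputable def meanφ : ℝ := ∫ y, (S.φ y : ℝ) ∂S.μ

theorem one_le_meanφ : 1 ≤ S.meanφ := by
  have : ∫ _ : S.Y, (1 : ℝ) ∂S.μ ≤ S.meanφ :=
    integral_mono (integrable_const _) S.integrable_φ fun y => by
      simpa using S.one_le_φ y
  simpa using this

theorem meanφ_pos : 0 < S.meanφ := one_pos.trans_le S.one_le_meanφ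

theorem summable_tail : Summable S.tail := by
  refine summable_of_sum_range_le (c := S.meanφ) S.tail_nonneg fun N => ?_
  have h1 : ∀ ℓ, S.tail ℓ = ∫ y, {y | ℓ < S.φ y}.indicator (fun _ => (1 : ℝ)) y ∂S.μ := fun ℓ => by
    rw [integral_indicator (S.measurableSet_lt_φ ℓ), setIntegral_const, smul_eq_mul, mul_one, tail]
  simp only [h1]
  rw [← integral_finsetSum _ fun ℓ _ => (integrable_const _).indicator (S.measurableSet_lt_φ ℓ)]
  refine integral_mono (integrable_finsetSum _ fun ℓ _ =>
    (integrable_const _).indicator (S.measurableSet_lt_φ ℓ)) S.integrable_φ fun y => ?_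
  simp only [indicator_apply, mem_ofPred_eq, Finset.sum_boole, Nat.cast_le]
  calc _ ≤ (Finset.range (S.φ y)).card := Finset.card_le_card fun ℓ hℓ => by
        simp only [Finset.mem_filter] at hℓ
        exact Finset.mem_range.2 hℓ.2
    _ = S.φ y := Finset.card_range _

/-- Integrals of sums along the tower. -/
theorem hasSum_setIntegral_tower {E : Type*} [NormedAddCommGroup E] [NormedSpace ℝ E]
    [CompleteSpace E]
    {f : ℕ → S.Y → E} (hf : ∀ ℓ, AEStronglyMeasurable (f ℓ) (S.μ.restrict {y | ℓ < S.φ y}))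
    {c : ℝ} (hc : ∀ᵐ y ∂S.μ, ∀ ℓ < S.φ y, ‖f ℓ y‖ ≤ c) :
    Integrable (fun y => ∑ ℓ ∈ Finset.range (S.φ y), f ℓ y) S.μ ∧
      HasSum (fun ℓ => ∫ y in {y | ℓ < S.φ y}, f ℓ y ∂S.μ)
        (∫ y, ∑ ℓ ∈ Finset.range (S.φ y), f ℓ y ∂S.μ) := by
  set g : ℕ → S.Y → E := fun ℓ => {y | ℓ < S.φ y}.indicator (f ℓ) with hg
  have hgm : ∀ ℓ, AEStronglyMeasurable (g ℓ) S.μ := fun ℓ =>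
    (aestronglyMeasurable_indicator_iff (S.measurableSet_lt_φ ℓ)).2 (hf ℓ)
  have hgb : ∀ ℓ, ∀ᵐ y ∂S.μ, ‖g ℓ y‖ ≤ {y | ℓ < S.φ y}.indicator (fun _ => c) y := fun ℓ => by
    filter_upwards [hc] with y hy
    by_cases h : ℓ < S.φ y
    · simpa [hg, h] using hy ℓ h
    · simp [hg, h]
  have hci : ∀ ℓ, Integrable ({y | ℓ < S.φ y}.indicator (fun _ => c)) S.μ := fun ℓ =>
    (integrable_const c).indicator (S.measurableSet_lt_φ ℓ)
  have hgi : ∀ ℓ, Integrable (g ℓ) S.μ := fun ℓ => (hci ℓ).mono' (hgm ℓ) (hgb ℓ)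
  have hsum : Summable fun ℓ => ∫ y, ‖g ℓ y‖ ∂S.μ := by
    refine Summable.of_nonneg_of_le (fun ℓ => integral_nonneg fun _ => norm_nonneg _) (fun ℓ => ?_)
      (S.summable_tail.mul_right c)
    refine (integral_mono_ae (hgi ℓ).norm (hci ℓ) (hgb ℓ)).trans_eq ?_
    rw [integral_indicator (S.measurableSet_lt_φ ℓ), setIntegral_const, smul_eq_mul, tail]
  have heq : ∀ y, ∑' ℓ, g ℓ y = ∑ ℓ ∈ Finset.range (S.φ y), f ℓ y := fun y => by
    rw [tsum_eq_sum (s := Finset.range (S.φ y))]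
    · refine Finset.sum_congr rfl fun ℓ hℓ => ?_
      simp [hg, Finset.mem_range.1 hℓ]
    · intro ℓ hℓ
      simp [hg, not_lt.1 (fun h => hℓ (Finset.mem_range.2 h))]
  have hmain := hasSum_integral_of_summable_integral_norm hgi hsum
  simp only [heq] at hmain
  simp only [hg, integral_indicator (S.measurableSet_lt_φ _)] at hmain
  refine ⟨?_, hmain⟩
  have hmeas : AEStronglyMeasurable (fun y => ∑ ℓ ∈ Finset.range (S.φ y), f ℓ y) S.μ := by
    refine aestronglyMeasurable_of_tendsto_ae atTop
      (f := fun N y => ∑ ℓ ∈ Finset.range N, g ℓ y)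
      (fun N => Finset.aestronglyMeasurable_fun_sum _ fun ℓ _ => hgm ℓ) (ae_of_all _ fun y => ?_)
    refine tendsto_const_nhds.congr' ?_
    filter_upwards [eventually_ge_atTop (S.φ y)] with N hN
    rw [← heq, tsum_eq_sum (s := Finset.range N)]
    intro ℓ hℓ
    have : S.φ y ≤ ℓ := hN.trans (not_lt.1 fun h => hℓ (Finset.mem_range.2 h))
    simp [hg, this]
  refine (S.integrable_φ.mul_const c).mono' hmeas ?_
  filter_upwards [hc] with y hy
  refine (norm_sum_le_of_le _ fun ℓ hℓ => hy ℓ (Finset.mem_range.1 hℓ)).trans_eq ?_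
  simp

theorem hasSum_tail : HasSum S.tail S.meanφ := by
  have := (S.hasSum_setIntegral_tower (f := fun _ _ => (1 : ℝ)) (c := 1)
    (fun ℓ => aestronglyMeasurable_const) (by simp)).2
  have h2 : S.tail = fun ℓ => S.μ.real {y | ℓ < S.φ y} := rfl
  rw [h2]
  simpa [meanφ] using this

/-! ### The measure on `X` -/

theorem lintegral_φ : ∫⁻ y, (S.φ y : ℝ≥0∞) ∂S.μ = ENNReal.ofReal S.meanφ := by
  rw [meanφ, ofReal_integral_eq_lintegral_ofReal S.integrable_φ (ae_of_all _ fun y => by simp)]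
  simp

/-- The part of the unnormalized measure on `X` that comes from level `ℓ` of the tower. -/
noncomputable def levelMeasure (ℓ : ℕ) : Measure X :=
  Measure.map (fun y : S.Y => S.T^[ℓ] (y : X)) (S.μ.restrict {y | ℓ < S.φ y})

/-- Slicing the tower by level reduces statements about `μX` to countably many statements about `μ`
on the sets `{φ > ℓ}`. -/
theorem μX_eq : S.μX = (ENNReal.ofReal S.meanφ)⁻¹ •
    Measure.sum S.levelMeasure := by
  have hD : MeasurableSet {p : S.Y × ℕ | p.2 < S.φ p.1} :=
    measurableSet_lt measurable_snd (S.measurable_φ.comp measurable_fst)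
  have hq : Measurable fun p : S.Y × ℕ => S.T^[p.2] (p.1 : X) :=
    measurable_from_prod_countable_left fun ℓ => S.measurable_orbit ℓ
  have hproj : Measurable S.proj := hq.comp measurable_subtype_coe
  ext s hs
  rw [μX, Measure.map_apply hproj hs, towerMeasure, lintegral_φ, Measure.smul_apply,
    Measure.smul_apply, Measure.sum_apply _ hs]
  refine congrArg _ (((MeasurableEmbedding.subtype_coe hD).comap_apply _ _).trans ?_)
  have himg : (Subtype.val : S.Tower → S.Y × ℕ) '' (S.proj ⁻¹' s) =
      {p : S.Y × ℕ | p.2 < S.φ p.1} ∩ (fun p : S.Y × ℕ => S.T^[p.2] (p.1 : X)) ⁻¹' s := by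
    ext p
    constructor
    · rintro ⟨q, hq, rfl⟩
      exact ⟨q.2, hq⟩
    · rintro ⟨h1, h2⟩
      exact ⟨⟨p, h1⟩, h2, rfl⟩
  refine (congrArg (S.μ.prod Measure.count) himg).trans ?_
  rw [Measure.prod_apply_symm (hD.inter (hq hs)), lintegral_count]
  refine tsum_congr fun ℓ => ?_
  rw [levelMeasure, Measure.map_apply (S.measurable_orbit ℓ) hs,
    Measure.restrict_apply (S.measurable_orbit ℓ hs), inter_comm]
  rfl

theorem ae_μX_imp {p : X → Prop} (h : ∀ᵐ x ∂S.μX, p x) :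
    ∀ᵐ y ∂S.μ, ∀ ℓ < S.φ y, p (S.T^[ℓ] (y : X)) := by
  rw [μX_eq, Measure.ae_ennreal_smul_measure_iff (by simp), Measure.ae_sum_iff] at h
  rw [ae_all_iff]
  intro ℓ
  have := ae_of_ae_map (S.measurable_orbit ℓ).aemeasurable (h ℓ)
  exact (ae_restrict_iff' (S.measurableSet_lt_φ ℓ)).1 this

theorem ae_μX_of {p : X → Prop} (hp : MeasurableSet {x | p x})
    (h : ∀ᵐ y ∂S.μ, ∀ ℓ < S.φ y, p (S.T^[ℓ] (y : X))) : ∀ᵐ x ∂S.μX, p x := by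
  rw [μX_eq, Measure.ae_ennreal_smul_measure_iff (by simp), Measure.ae_sum_iff]
  intro ℓ
  rw [levelMeasure, ae_map_iff (S.measurable_orbit ℓ).aemeasurable hp,
    ae_restrict_iff' (S.measurableSet_lt_φ ℓ)]
  filter_upwards [h] with y hy using hy ℓ

/-- Almost every orbit starting in `Y` stays in a set of full measure. -/
theorem ae_forall_iterate {p : X → Prop} (h : ∀ᵐ x ∂S.μX, p x) :
    ∀ᵐ y : S.Y ∂S.μ, ∀ m, p (S.T^[m] (y : X)) := by
  rw [ae_all_iff]
  intro m
  induction m using Nat.strong_induction_on with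
  | _ m ih =>
    -- Past the return time, `T^m y = T^(m - φ y) (F y)` has a smaller exponent, and `F` preserves
    -- `μ`, so the induction hypothesis may be applied at `F y`.
    have h1 : ∀ᵐ y : S.Y ∂S.μ, ∀ m' < m, p (S.T^[m'] (S.F y : X)) :=
      S.measurePreserving_F.quasiMeasurePreserving.ae
        (p := fun y : S.Y => ∀ m' < m, p (S.T^[m'] (y : X)))
        (ae_all_iff.2 fun m' => by
          by_cases hm : m' < m
          · filter_upwards [ih m' hm] with y hy _ using hy
          · exact ae_of_all _ fun y h => absurd h hm)
    filter_upwards [h1, S.ae_μX_imp h] with y hy1 hy2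
    by_cases hm : m < S.φ y
    · exact hy2 m hm
    · rw [S.iterate_eq_iterate_F (not_lt.1 hm)]
      exact hy1 _ (by have := S.one_le_φ y; omega)

/-- Of the `T`-invariance of `μX` only this preservation of null sets is needed. A measurable null
superset is chosen because passing from orbits back to `μX` requires measurability. -/
theorem ae_μX_iterate {p : X → Prop} (h : ∀ᵐ x ∂S.μX, p x) (n : ℕ) :
    ∀ᵐ x ∂S.μX, p (S.T^[n] x) := by
  obtain ⟨t, ht, htm, ht0⟩ := exists_measurable_superset_of_null (ae_iff.1 h)
  have h1 : ∀ᵐ x ∂S.μX, x ∈ tᶜ := by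
    rw [ae_iff]; simpa using ht0
  have h2 : ∀ᵐ x ∂S.μX, S.T^[n] x ∈ tᶜ := by
    refine S.ae_μX_of ((S.measurable_T.iterate n) htm.compl) ?_
    filter_upwards [S.ae_forall_iterate h1] with y hy ℓ _
    rw [← Function.iterate_add_apply]
    exact hy _
  filter_upwards [h2] with x hx
  by_contra hp
  exact hx (ht hp)

/-- A Kac formula. The bound along tower orbits makes `h` integrable for the finite sum of the level
measures, so the integral splits over levels. -/
theorem integral_μX {h : X → ℝ} (hm : AEStronglyMeasurable h S.μX) {c : ℝ}
    (hc : ∀ᵐ y ∂S.μ, ∀ ℓ < S.φ y, ‖h (S.T^[ℓ] (y : X))‖ ≤ c) :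
    S.meanφ * ∫ x, h x ∂S.μX = ∫ y, ∑ ℓ ∈ Finset.range (S.φ y), h (S.T^[ℓ] (y : X)) ∂S.μ := by
  wlog hs : StronglyMeasurable h generalizing h
  · have he := hm.ae_eq_mk
    have he' := S.ae_μX_imp he
    have hmk : StronglyMeasurable (hm.mk h) := hm.stronglyMeasurable_mk
    rw [integral_congr_ae he, this hmk.aestronglyMeasurable ?_ hmk]
    · refine integral_congr_ae ?_
      filter_upwards [he'] with y hy
      exact Finset.sum_congr rfl fun ℓ hℓ => (hy ℓ (Finset.mem_range.1 hℓ)).symm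
    · filter_upwards [he', hc] with y hy hyc ℓ hℓ
      rw [← hy ℓ hℓ]
      exact hyc ℓ hℓ
  have hb : ∀ᵐ x ∂S.μX, ‖h x‖ ≤ c :=
    S.ae_μX_of (measurableSet_le hs.norm.measurable measurable_const) hc
  have hsum := (S.hasSum_setIntegral_tower (f := fun ℓ y => h (S.T^[ℓ] (y : X)))
    (fun ℓ => (hs.comp_measurable (S.measurable_orbit ℓ)).aestronglyMeasurable) hc).2
  set ν := Measure.sum S.levelMeasure with hν
  have hpos := S.meanφ_pos
  rw [μX_eq, Measure.ae_ennreal_smul_measure_iff (by simp)] at hb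
  have hfin : IsFiniteMeasure ν := by
    refine ⟨?_⟩
    rw [hν, Measure.sum_apply _ MeasurableSet.univ]
    have h1 : ∀ ℓ, S.levelMeasure ℓ univ =
        ENNReal.ofReal (S.tail ℓ) := fun ℓ => by
      rw [levelMeasure, Measure.map_apply (S.measurable_orbit ℓ) MeasurableSet.univ, preimage_univ,
        Measure.restrict_apply_univ, tail, ofReal_measureReal]
    simp only [h1]
    rw [← ENNReal.ofReal_tsum_of_nonneg S.tail_nonneg S.summable_tail]
    exact ENNReal.ofReal_lt_top
  have hint : Integrable h ν := Integrable.of_bound hs.aestronglyMeasurable c hb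
  rw [μX_eq, integral_smul_measure, integral_sum_measure hint, ENNReal.toReal_inv,
    ENNReal.toReal_ofReal hpos.le, smul_eq_mul, mul_inv_cancel_left₀ hpos.ne', ← hsum.tsum_eq]
  refine tsum_congr fun ℓ => ?_
  rw [levelMeasure, integral_map (S.measurable_orbit ℓ).aemeasurable hs.aestronglyMeasurable]

end InducingScheme

/-! ### Functionals on the observable space -/

namespace ObservableSpace

variable {Y : Type*} [MeasurableSpace Y] {μ : Measure Y}
  {B : Type*} [NormedAddCommGroup B] [NormedSpace ℂ B] (E : ObservableSpace μ B)

theorem EmbedsInLinfty.exists_ae_norm_le {E : ObservableSpace μ B} (h : E.EmbedsInLinfty) :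
    ∃ C : ℝ, 0 ≤ C ∧ ∀ b, ∀ᵐ y ∂μ, ‖E.toL1 b y‖ ≤ C * ‖b‖ := by
  obtain ⟨C, hC⟩ := h
  refine ⟨C, C.2, fun b => ?_⟩
  filter_upwards [ae_le_eLpNormEssSup (f := E.toL1 b) (μ := μ)] with y hy
  have h1 : ‖E.toL1 b y‖ₑ ≤ C * ‖b‖ₑ := hy.trans (by simpa using hC b)
  have h2 := ENNReal.toReal_mono (by finiteness) h1
  simpa using h2

theorem integrable_mul {s : Set Y} {u : Y → ℂ} {c : ℝ}
    (hu : AEStronglyMeasurable u (μ.restrict s)) (hc : ∀ᵐ y ∂μ.restrict s, ‖u y‖ ≤ c) (b : B) :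
    Integrable (fun y => E.toL1 b y * u y) (μ.restrict s) :=
  (L1.integrable_coeFn (E.toL1 b)).integrableOn.mul_bdd hu hc

variable [IsFiniteMeasure μ]

/-- Integration against a bounded function on a subset, as a functional on `B`. -/
theorem exists_functional {C : ℝ} (hC0 : 0 ≤ C) (hC : ∀ b, ∀ᵐ y ∂μ, ‖E.toL1 b y‖ ≤ C * ‖b‖)
    {s : Set Y} {u : Y → ℂ} {c : ℝ} (hc0 : 0 ≤ c)
    (hu : AEStronglyMeasurable u (μ.restrict s)) (hc : ∀ᵐ y ∂μ.restrict s, ‖u y‖ ≤ c) :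
    ∃ L : B →L[ℂ] ℂ, (∀ b, L b = ∫ y in s, E.toL1 b y * u y ∂μ) ∧ ‖L‖ ≤ C * c * μ.real s := by
  let L₀ : B →ₗ[ℂ] ℂ :=
    { toFun := fun b => ∫ y in s, E.toL1 b y * u y ∂μ
      map_add' := fun a b => by
        rw [← integral_add (E.integrable_mul hu hc a) (E.integrable_mul hu hc b), map_add]
        refine integral_congr_ae (ae_restrict_of_ae ?_)
        filter_upwards [Lp.coeFn_add (E.toL1 a) (E.toL1 b)] with y hy
        rw [hy, Pi.add_apply, add_mul]
      map_smul' := fun z b => by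
        rw [RingHom.id_apply, ← integral_smul, map_smul]
        refine integral_congr_ae (ae_restrict_of_ae ?_)
        filter_upwards [Lp.coeFn_smul z (E.toL1 b)] with y hy
        rw [hy, Pi.smul_apply, smul_mul_assoc] }
  have hL : ∀ b, ‖L₀ b‖ ≤ C * c * μ.real s * ‖b‖ := fun b => by
    have h1 : ∀ᵐ y ∂μ.restrict s, ‖E.toL1 b y * u y‖ ≤ C * ‖b‖ * c := by
      filter_upwards [ae_restrict_of_ae (hC b), hc] with y hy1 hy2
      rw [norm_mul]
      exact mul_le_mul hy1 hy2 (norm_nonneg _) ((norm_nonneg _).trans hy1)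
    refine (norm_integral_le_of_norm_le_const h1).trans_eq ?_
    rw [measureReal_restrict_apply_univ]
    ring
  exact ⟨L₀.mkContinuous _ hL, fun b => rfl,
    L₀.mkContinuous_norm_le (by positivity) hL⟩

/-- Indicators are already enough test functions in `L^∞` to separate `L¹`, so identities in `B` can
be checked by duality. -/
theorem eq_of_integral_mul_eq {a b : B}
    (h : ∀ u : Y → ℂ, MemLp u ⊤ μ → ∫ y, E.toL1 a y * u y ∂μ = ∫ y, E.toL1 b y * u y ∂μ) :
    a = b := by
  refine E.injective (Lp.ext ?_)
  refine (L1.integrable_coeFn _).ae_eq_of_forall_setIntegral_eq _ _ (L1.integrable_coeFn _)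
    fun s hs _ => ?_
  have h1 := h (s.indicator fun _ => 1) ((memLp_const _).indicator hs)
  have h2 : ∀ x : B, ∀ y, E.toL1 x y * s.indicator (fun _ => (1 : ℂ)) y =
      s.indicator (E.toL1 x) y := fun x y => by
    by_cases hy : y ∈ s <;> simp [hy]
  simpa only [h2, integral_indicator hs] using h1

end ObservableSpace

/-! ### The renewal operators of an excellent scheme -/

namespace InducingScheme

variable {X : Type*} [MeasurableSpace X] (S : InducingScheme X)
  {B : Type*} [NormedAddCommGroup B] [NormedSpace ℂ B] (E : ObservableSpace S.μ B)

theorem hasSum_setIntegral_φ_eq {V : Type*} [NormedAddCommGroup V] [NormedSpace ℝ V]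
    {f : S.Y → V} (hf : Integrable f S.μ) (j : ℕ) :
    HasSum (fun k => ∫ y in {y | S.φ y = j + 1 + k}, f y ∂S.μ)
      (∫ y in {y | j < S.φ y}, f y ∂S.μ) := by
  have h1 : {y | j < S.φ y} = ⋃ k : ℕ, {y | S.φ y = j + 1 + k} := by
    ext y
    simp only [mem_ofPred_eq, mem_iUnion]
    constructor
    · intro h
      exact ⟨S.φ y - (j + 1), by omega⟩
    · rintro ⟨k, hk⟩
      omega
  rw [h1]
  refine hasSum_integral_iUnion (fun k => S.measurableSet_φ_eq _) ?_ hf.integrableOn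
  intro k l hkl
  refine Set.disjoint_left.2 fun y hy hy' => hkl ?_
  simp only [mem_ofPred_eq] at hy hy'
  omega

theorem hasSum_measureReal_φ_eq (j : ℕ) :
    HasSum (fun k => S.μ.real {y | S.φ y = j + 1 + k}) (S.tail j) := by
  have := S.hasSum_setIntegral_φ_eq (integrable_const (1 : ℝ)) j
  simp only [setIntegral_const, smul_eq_mul, mul_one] at this
  exact this

theorem memLp_comp_F {u : S.Y → ℂ} (hu : MemLp u ⊤ S.μ) : MemLp (fun y => u (S.F y)) ⊤ S.μ :=
  hu.comp_measurePreserving S.measurePreserving_F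

/-- The operators `Z j = ∑_{k > j} R_k` of an excellent inducing scheme, given by
`∫ (Z j b) u dμ = ∫_{φ > j} b (u ∘ F) dμ`, together with the class `e` of the constant function `1`
and the integral `ι`. -/
structure RenewalOperators where
  Z : ℕ → B →L[ℂ] B
  e : B
  ι : B →L[ℂ] ℂ
  C : ℝ
  C_nonneg : 0 ≤ C
  D : ℝ
  D_nonneg : 0 ≤ D
  toL1_e : (E.toL1 e : S.Y → ℂ) =ᵐ[S.μ] fun _ => 1
  ι_apply : ∀ b, ι b = ∫ y, E.toL1 b y ∂S.μ
  norm_Z_le : ∀ j, ‖Z j‖ ≤ C * S.tail j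
  ae_norm_le : ∀ b, ∀ᵐ y ∂S.μ, ‖E.toL1 b y‖ ≤ D * ‖b‖
  integral_Z : ∀ (j : ℕ) (b : B) (u : S.Y → ℂ), MemLp u ⊤ S.μ →
    ∫ y, E.toL1 (Z j b) y * u y ∂S.μ = ∫ y in {y | j < S.φ y}, E.toL1 b y * u (S.F y) ∂S.μ
  sub_mul_eq_zero : (1 - Z 0) * ι.smulRight e = 0
  isUnit_regularized : ∀ z : ℂ, ‖z‖ ≤ 1 →
    IsUnit (regularized (Z 0) (ι.smulRight e) (∑' j, z ^ j • Z j) z)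

/-- The bounds `‖R_k‖ ≤ C μ(φ = k)` sum to `‖Z_j‖ ≤ C μ(φ > j)`, and the duality formula passes
through the series. The spectral hypotheses give invertibility of the regularized operator:
simplicity at `1`, absence of the eigenvalue elsewhere. -/
theorem IsExcellent.nonempty_renewalOperators [CompleteSpace B] {E : ObservableSpace S.μ B}
    (hS : S.IsExcellent E) (hB : E.EmbedsInLinfty) : Nonempty (S.RenewalOperators E) := by
  obtain ⟨Rn, hR, ⟨C, hC⟩, hsimple, hspec⟩ := hS
  obtain ⟨C₁, hC₁0, hC₁⟩ := hB.exists_ae_norm_le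
  obtain ⟨e, he⟩ := E.const_mem 1
  obtain ⟨ι, hι, -⟩ := E.exists_functional hC₁0 hC₁ (s := univ) (u := fun _ => 1) zero_le_one
    aestronglyMeasurable_const (by simp)
  simp only [mul_one, Measure.restrict_univ] at hι
  -- the functional given by a bounded function
  have hfun : ∀ u : S.Y → ℂ, MemLp u ⊤ S.μ →
      ∃ L : B →L[ℂ] ℂ, ∀ b, L b = ∫ y, E.toL1 b y * u y ∂S.μ := fun u hu => by
    obtain ⟨L, hL, -⟩ := E.exists_functional hC₁0 hC₁ (s := univ) (u := u)
      (c := (eLpNorm u ⊤ S.μ).toReal) ENNReal.toReal_nonneg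
      (by simpa using hu.1) (by
        rw [Measure.restrict_univ]
        filter_upwards [ae_le_eLpNormEssSup (f := u) (μ := S.μ)] with y hy
        have := ENNReal.toReal_mono hu.eLpNorm_ne_top (by simpa using hy)
        simpa using this)
    exact ⟨L, by simpa using hL⟩
  have hint : ∀ (u : S.Y → ℂ), MemLp u ⊤ S.μ → ∀ b, Integrable (fun y => E.toL1 b y * u y) S.μ :=
    fun u hu b => (L1.integrable_coeFn (E.toL1 b)).mul_bdd hu.1 (by
      filter_upwards [ae_le_eLpNormEssSup (f := u) (μ := S.μ)] with y hy
      have := ENNReal.toReal_mono hu.eLpNorm_ne_top (by simpa using hy)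
      simpa using this)
  have hRu : ∀ n b u, MemLp u ⊤ S.μ → ∫ y, E.toL1 (Rn n b) y * u y ∂S.μ =
      ∫ y in {y | S.φ y = n}, E.toL1 b y * u (S.F y) ∂S.μ := fun n b u hu => by
    rw [hR n b u hu, ← integral_indicator (S.measurableSet_φ_eq n)]
    refine integral_congr_ae (ae_of_all _ fun y => ?_)
    simp only [indicator_apply]
    split_ifs <;> simp
  -- Return times are at least `1`, so the series starting at index `0` is the same as `Z 0`.
  have hR0 : Rn 0 = 0 := by
    ext b
    refine E.eq_of_integral_mul_eq fun u hu => ?_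
    have h0 : {y | S.φ y = 0} = ∅ := eq_empty_of_forall_notMem fun y hy => by
      have := S.one_le_φ y
      simp only [mem_ofPred_eq] at hy
      omega
    rw [hRu 0 b u hu, h0, Measure.restrict_empty, integral_zero_measure]
    simp
  have hC' : ∀ j k, ‖Rn (j + 1 + k)‖ ≤ C * S.μ.real {y | S.φ y = j + 1 + k} := fun j k =>
    hC _ (by omega)
  have hsumj : ∀ j, Summable fun k => Rn (j + 1 + k) := fun j =>
    Summable.of_norm_bounded ((S.hasSum_measureReal_φ_eq j).summable.mul_left C) (hC' j)
  have hRsum : Summable fun n => ‖Rn n‖ := by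
    rw [← summable_nat_add_iff 1]
    refine Summable.of_nonneg_of_le (fun _ => norm_nonneg _) (fun k => ?_)
      ((S.hasSum_measureReal_φ_eq 0).summable.mul_left C)
    have := hC' 0 k
    rwa [zero_add, add_comm 1 k] at this ⊢
  set Z : ℕ → B →L[ℂ] B := fun j => ∑' k, Rn (j + 1 + k) with hZ
  have hZn : ∀ j, ‖Z j‖ ≤ C * S.tail j := fun j =>
    tsum_of_norm_bounded ((S.hasSum_measureReal_φ_eq j).mul_left C) (hC' j)
  have hZu : ∀ (j : ℕ) (b : B) (u : S.Y → ℂ), MemLp u ⊤ S.μ →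
      ∫ y, E.toL1 (Z j b) y * u y ∂S.μ =
        ∫ y in {y | j < S.φ y}, E.toL1 b y * u (S.F y) ∂S.μ := fun j b u hu => by
    obtain ⟨L, hL⟩ := hfun u hu
    have h1 : HasSum (fun k => L (Rn (j + 1 + k) b)) (L (Z j b)) :=
      (((hsumj j).hasSum).mapL (ContinuousLinearMap.apply ℂ B b)).mapL L
    simp only [hL, hRu _ _ u hu] at h1
    exact h1.unique (S.hasSum_setIntegral_φ_eq (hint _ (S.memLp_comp_F hu) b) j)
  have hφ0 : {y | 0 < S.φ y} = univ := eq_univ_of_forall fun y => S.one_le_φ y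
  have hZsub : ∀ j, Z j = Rn (j + 1) + Z (j + 1) := fun j => by
    simp only [hZ]
    rw [(hsumj j).tsum_eq_zero_add]
    simp only [add_left_comm, add_comm]
  have hZ0 : Z 0 = ∑' n, Rn n := by
    rw [(hRsum.of_norm).tsum_eq_zero_add, hR0, zero_add]
    simp only [hZ, zero_add, add_comm]
  have hZe : Z 0 e = e := by
    refine E.eq_of_integral_mul_eq fun u hu => ?_
    rw [hZu 0 e u hu, hφ0, Measure.restrict_univ]
    have h1 : ∫ y, E.toL1 e y * u (S.F y) ∂S.μ = ∫ y, u (S.F y) ∂S.μ := integral_congr_ae (by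
      filter_upwards [he] with y hy
      rw [hy, one_mul])
    have h2 : ∫ y, E.toL1 e y * u y ∂S.μ = ∫ y, u y ∂S.μ := integral_congr_ae (by
      filter_upwards [he] with y hy
      rw [hy, one_mul])
    have h3 : AEStronglyMeasurable u (S.μ.map S.F) := by
      rw [S.measurePreserving_F.map_eq]; exact hu.1
    rw [h1, h2, ← integral_map S.measurePreserving_F.aemeasurable h3,
      S.measurePreserving_F.map_eq]
  have hιZj : ∀ j b, ι (Z j b) = ∫ y in {y | j < S.φ y}, E.toL1 b y ∂S.μ := fun j b => by
    have := hZu j b (fun _ => 1) (memLp_const _)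
    simpa [hι] using this
  have hιZ : ∀ b, ι (Z 0 b) = ι b := fun b => by
    rw [hιZj, hφ0, Measure.restrict_univ, hι]
  have hιe : ι e = 1 := by
    rw [hι, integral_congr_ae he]
    simp
  have hP : (1 - Z 0) * ι.smulRight e = 0 := by
    ext b
    simp [hZe]
  have hZsum : Summable fun j => ‖Z j‖ :=
    Summable.of_nonneg_of_le (fun _ => norm_nonneg _) hZn (S.summable_tail.mul_left C)
  have hιZe : ∀ j, ι (Z j e) = S.tail j := fun j => by
    rw [hιZj, setIntegral_congr_ae (g := fun _ => (1 : ℂ)) (S.measurableSet_lt_φ j)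
      (he.mono fun y hy _ => hy)]
    simp [tail]
  have hC0 : 0 ≤ C := by
    have := (norm_nonneg _).trans (hZn 0)
    rwa [S.tail_zero, mul_one] at this
  refine ⟨⟨Z, e, ι, C, hC0, C₁, hC₁0, he, hι, hZn, hC₁, hZu, hP, fun z hz => ?_⟩⟩
  by_cases hz1 : z = 1
  · subst hz1
    refine isUnit_regularized_one ι hιe hZe hιZ ?_ (by rw [hZ0]; exact hsimple)
    -- `ι (V(1) e) = ∑ μ(φ > j)` is the mean return time, in particular nonzero.
    have h1 : HasSum (fun j => ι (Z j e)) (ι ((∑' j, (1 : ℂ) ^ j • Z j) e)) := by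
      simp only [one_pow, one_smul]
      exact ((hZsum.of_norm.hasSum).mapL (ContinuousLinearMap.apply ℂ B e)).mapL ι
    simp only [hιZe] at h1
    have h2 := h1.unique (Complex.hasSum_ofReal.2 S.hasSum_tail)
    rw [h2]
    exact_mod_cast S.meanφ_pos.ne'
  · refine isUnit_regularized_of_ne_one hP ?_ hz1 ?_
    · ext b
      simp [hιe]
    · have h1 := hspec z hz hz1
      rw [spectrum.notMem_iff, map_one] at h1
      convert h1 using 1
      have hzs : ∀ {c : ℕ → B →L[ℂ] B}, Summable (fun j => ‖c j‖) →
          Summable fun j => z ^ j • c j := fun {c} hc =>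
        Summable.of_norm_bounded hc fun j => by
          rw [norm_smul, norm_pow]
          exact mul_le_of_le_one_left (norm_nonneg _) (pow_le_one₀ (norm_nonneg _) hz)
      have h2 := (hzs hZsum).tsum_eq_zero_add
      have h3 := (hzs hRsum).tsum_eq_zero_add
      -- Summation by parts with `R_{j+1} = Z_j - Z_{j+1}` identifies `1 - R(z)` with `1 - Z_0 + (1
      -- - z) V(z)`.
      have h4 : ∑' j, z ^ (j + 1) • Rn (j + 1) =
          z • (∑' j, z ^ j • Z j) - ∑' j, z ^ (j + 1) • Z (j + 1) := by
        rw [← (hzs hZsum).tsum_const_smul z, ← ((hzs hZsum).const_smul z).tsum_sub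
          ((summable_nat_add_iff 1).2 (hzs hZsum))]
        refine tsum_congr fun j => ?_
        rw [hZsub j, pow_succ']
        module
      rw [h3, hR0, smul_zero, zero_add, h4, eq_sub_of_add_eq' h2.symm]
      module

end InducingScheme

namespace InducingScheme

variable {X : Type*} [MeasurableSpace X] (S : InducingScheme X)
  {B : Type*} [NormedAddCommGroup B] [NormedSpace ℂ B] {E : ObservableSpace S.μ B}

/-! ### Exchangeable observables -/

/-- The supremum is over a bounded set because injectivity of `toL1` makes the class of each derived
function unique. -/
theorem Exchangeable.norm_le_exNorm {v : X → ℝ} (hv : S.Exchangeable E v) {u : S.Y → ℝ}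
    (hu : u ∈ S.derived v) {b : B} (hb : S.Represents E b u) : ‖b‖ ≤ S.exNorm E v := by
  obtain ⟨M, hM⟩ := hv
  refine le_csSup ⟨M, ?_⟩ ⟨u, hu, b, hb, rfl⟩
  rintro r ⟨u', hu', b', hb', rfl⟩
  obtain ⟨b'', hb'', hn⟩ := hM u' hu'
  have : b' = b'' := E.injective (Lp.ext (hb'.trans hb''.symm))
  rwa [this]

/-- The function derived from `v` that is `v (T ^ (φ - k - 1))` where `k < φ`. -/
noncomputable def derivedFromTop (v : X → ℝ) (k : ℕ) (y : S.Y) : ℝ :=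
  if k < S.φ y then v (S.T^[S.φ y - 1 - k] (y : X)) else v (y : X)

/-- The level `φ - 1 - k` depends on `y` only through `φ y`, as a derived function requires. Where
`k ≥ φ y` level `0` is a mere filler, since only `{φ > k}` is ever integrated over. -/
theorem derivedFromTop_mem (v : X → ℝ) (k : ℕ) : S.derivedFromTop v k ∈ S.derived v := by
  intro n hn
  refine ⟨if k < n then n - 1 - k else 0, by split_ifs <;> omega, fun y hy => ?_⟩
  simp only [derivedFromTop, hy]
  split_ifs <;> rfl

theorem Exchangeable.exists_class {v : X → ℝ} (hv : S.Exchangeable E v) (k : ℕ) :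
    ∃ b : B, S.Represents E b (S.derivedFromTop v k) ∧ ‖b‖ ≤ S.exNorm E v := by
  obtain ⟨M, hM⟩ := id hv
  obtain ⟨b, hb, -⟩ := hM _ (S.derivedFromTop_mem v k)
  exact ⟨b, hb, hv.norm_le_exNorm S (S.derivedFromTop_mem v k) hb⟩

theorem Exchangeable.exNorm_nonneg {v : X → ℝ} (hv : S.Exchangeable E v) :
    0 ≤ S.exNorm E v := by
  obtain ⟨b, -, hb⟩ := hv.exists_class S 0
  exact (norm_nonneg _).trans hb

/-- The countably many functions `derivedFromTop v k` run through all levels of the tower, and each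
is bounded through the embedding of `B` in `L^∞`. -/
theorem Exchangeable.ae_norm_le (O : S.RenewalOperators E) {v : X → ℝ}
    (hv : S.Exchangeable E v) :
    ∀ᵐ y ∂S.μ, ∀ ℓ < S.φ y, ‖v (S.T^[ℓ] (y : X))‖ ≤ O.D * S.exNorm E v := by
  have h1 : ∀ᵐ y ∂S.μ, ∀ k, ‖S.derivedFromTop v k y‖ ≤ O.D * S.exNorm E v := by
    rw [ae_all_iff]
    intro k
    obtain ⟨b, hb, hbn⟩ := hv.exists_class S k
    filter_upwards [hb, O.ae_norm_le b] with y hy1 hy2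
    rw [hy1, Complex.norm_real] at hy2
    exact hy2.trans (mul_le_mul_of_nonneg_left hbn O.D_nonneg)
  filter_upwards [h1] with y hy ℓ hℓ
  have h2 := hy (S.φ y - 1 - ℓ)
  rw [derivedFromTop, if_pos (by omega)] at h2
  convert h2 using 4
  omega

/-! ### Reduction to bounded measurable observables -/

theorem norm_integral_μX_le {h : X → ℝ} (hm : AEStronglyMeasurable h S.μX) {c : ℝ}
    (hc : ∀ᵐ y ∂S.μ, ∀ ℓ < S.φ y, ‖h (S.T^[ℓ] (y : X))‖ ≤ c) : ‖∫ x, h x ∂S.μX‖ ≤ c := by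
  have h1 := S.integral_μX hm hc
  have h2 : ‖∫ y, ∑ ℓ ∈ Finset.range (S.φ y), h (S.T^[ℓ] (y : X)) ∂S.μ‖ ≤ S.meanφ * c := by
    rw [meanφ, ← integral_mul_const]
    refine norm_integral_le_of_norm_le (S.integrable_φ.mul_const c) ?_
    filter_upwards [hc] with y hy
    refine (norm_sum_le_of_le _ fun ℓ hℓ => hy ℓ (Finset.mem_range.1 hℓ)).trans_eq ?_
    simp
  rw [← h1, norm_mul, Real.norm_of_nonneg S.meanφ_pos.le] at h2
  exact le_of_mul_le_mul_left h2 S.meanφ_pos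

theorem corr_congr (v : X → ℝ) {w w' : X → ℝ} (h : w =ᵐ[S.μX] w') (n : ℕ) :
    S.corr v w n = S.corr v w' n := by
  rw [corr, corr, integral_congr_ae h]
  congr 1
  refine integral_congr_ae ?_
  filter_upwards [S.ae_μX_iterate h n] with x hx
  rw [hx]

/-- The tail sum `∑_{j ≥ n} μ(φ > j)`. -/
noncomputable def tailSum (n : ℕ) : ℝ := ∑' j, S.tail (n + j)

theorem tailSum_nonneg (n : ℕ) : 0 ≤ S.tailSum n := tsum_nonneg fun _ => S.tail_nonneg _

theorem tailSum_succ (n : ℕ) : S.tailSum n = S.tail n + S.tailSum (n + 1) := by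
  have h : Summable fun j => S.tail (n + j) := by
    simpa only [add_comm n] using (summable_nat_add_iff n).2 S.summable_tail
  rw [tailSum, h.tsum_eq_zero_add, tailSum]
  simp only [add_zero, add_assoc, add_comm 1]

/-- Truncating a series whose terms are bounded by the tail. -/
theorem norm_sum_range_sub_le {V : Type*} [NormedAddCommGroup V] [CompleteSpace V] {f : ℕ → V}
    {a : V} (hf : HasSum f a) {c : ℝ} (hc : ∀ j, ‖f j‖ ≤ c * S.tail j) (n : ℕ) :
    ‖∑ j ∈ Finset.range n, f j - a‖ ≤ c * S.tailSum n := by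
  have h1 := (hf.summable.sum_add_tsum_nat_add n)
  rw [hf.tsum_eq] at h1
  rw [← h1, sub_add_cancel_left, norm_neg]
  have h : Summable fun j => S.tail (n + j) := by
    simpa only [add_comm n] using (summable_nat_add_iff n).2 S.summable_tail
  refine tsum_of_norm_bounded (h.hasSum.mul_left c) fun j => ?_
  rw [add_comm n]
  exact hc _

/-- The error made in the leading term by truncating. -/
theorem norm_mul_div_sub_le {a a₀ b b₀ : ℂ} {t t₀ c d σ : ℝ} (hc : 0 ≤ c) (hd : 0 ≤ d)
    (ht : 1 ≤ t) (ht₀ : 1 ≤ t₀) (hb : ‖b‖ ≤ d * t₀) (ha₀ : ‖a₀‖ ≤ c * t₀) (hb₀ : ‖b₀‖ ≤ d * t₀)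
    (ha : ‖a - a₀‖ ≤ c * σ) (hbb : ‖b - b₀‖ ≤ d * σ) (htt : |t - t₀| ≤ σ) :
    ‖a * b / t - a₀ * b₀ / t₀‖ ≤ 3 * t₀ * (c * d * σ) := by
  have hσ : 0 ≤ σ := (abs_nonneg _).trans htt
  have ht0 : (t : ℂ) ≠ 0 := by exact_mod_cast (by linarith : t ≠ 0)
  have ht00 : (t₀ : ℂ) ≠ 0 := by exact_mod_cast (by linarith : t₀ ≠ 0)
  have htn : ‖(t : ℂ)‖ = t := by rw [Complex.norm_real, Real.norm_of_nonneg (by linarith)]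
  have htn₀ : ‖(t₀ : ℂ)‖ = t₀ := by rw [Complex.norm_real, Real.norm_of_nonneg (by linarith)]
  have h1 : a * b / t - a₀ * b₀ / t₀ =
      (a - a₀) * b / t + a₀ * (b - b₀) / t - a₀ * b₀ * ((t - t₀ : ℝ) : ℂ) / (t * t₀) := by
    push_cast
    field_simp
    ring
  have e1 : ‖(a - a₀) * b / t‖ ≤ t₀ * (c * d * σ) := by
    rw [norm_div, norm_mul, htn]
    refine div_le_of_le_mul₀ (by linarith) (by positivity) ?_
    calc ‖a - a₀‖ * ‖b‖ ≤ c * σ * (d * t₀) := by gcongr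
      _ = t₀ * (c * d * σ) := by ring
      _ ≤ _ := le_mul_of_one_le_right (by positivity) ht
  have e2 : ‖a₀ * (b - b₀) / t‖ ≤ t₀ * (c * d * σ) := by
    rw [norm_div, norm_mul, htn]
    refine div_le_of_le_mul₀ (by linarith) (by positivity) ?_
    calc ‖a₀‖ * ‖b - b₀‖ ≤ c * t₀ * (d * σ) := by gcongr
      _ = t₀ * (c * d * σ) := by ring
      _ ≤ _ := le_mul_of_one_le_right (by positivity) ht
  have e3 : ‖a₀ * b₀ * ((t - t₀ : ℝ) : ℂ) / (t * t₀)‖ ≤ t₀ * (c * d * σ) := by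
    rw [norm_div, norm_mul, norm_mul, norm_mul, htn, htn₀, Complex.norm_real, Real.norm_eq_abs]
    refine div_le_of_le_mul₀ (by positivity) (by positivity) ?_
    calc ‖a₀‖ * ‖b₀‖ * |t - t₀| ≤ c * t₀ * (d * t₀) * σ := by gcongr
      _ = t₀ * (c * d * σ) * (1 * t₀) := by ring
      _ ≤ _ := by gcongr
  rw [h1]
  refine (norm_sub_le _ _).trans ?_
  linarith [norm_add_le ((a - a₀) * b / t) (a₀ * (b - b₀) / t)]

end InducingScheme

/-! ### Renewal equation and decomposition of correlations -/

namespace InducingScheme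

variable {X : Type*} [MeasurableSpace X] (S : InducingScheme X)
  {B : Type*} [NormedAddCommGroup B] [NormedSpace ℂ B] {E : ObservableSpace S.μ B}

theorem setIntegral_lt_φ_eq_add {V : Type*} [NormedAddCommGroup V] [NormedSpace ℝ V]
    {f : S.Y → V} (hf : Integrable f S.μ) (j : ℕ) :
    ∫ y in {y | j < S.φ y}, f y ∂S.μ =
      ∫ y in {y | S.φ y = j + 1}, f y ∂S.μ + ∫ y in {y | j + 1 < S.φ y}, f y ∂S.μ := by
  rw [← setIntegral_union _ (S.measurableSet_lt_φ _) hf.integrableOn hf.integrableOn]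
  · congr 2
    ext y
    simp only [mem_ofPred_eq, mem_union]
    omega
  · refine Set.disjoint_left.2 fun y hy hy' => ?_
    simp only [mem_ofPred_eq] at hy hy'
    omega

/-- The functionals `b ↦ ∫ b (w ∘ T ^ m)` and their restrictions to `{φ > m}` satisfy a renewal
equation. -/
theorem exists_renewal_functionals (O : S.RenewalOperators E) {w : X → ℝ}
    (hw : StronglyMeasurable w) {c : ℝ} (hc0 : 0 ≤ c)
    (hc : ∀ᵐ y : S.Y ∂S.μ, ∀ m, ‖w (S.T^[m] (y : X))‖ ≤ c) :
    ∃ W A : ℕ → B →L[ℂ] ℂ,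
      (∀ m b, W m b = ∫ y, E.toL1 b y * (w (S.T^[m] (y : X)) : ℂ) ∂S.μ) ∧
      (∀ m b, A m b = ∫ y in {y | m < S.φ y}, E.toL1 b y * (w (S.T^[m] (y : X)) : ℂ) ∂S.μ) ∧
      (∀ m, ‖A m‖ ≤ O.D * c * S.tail m) ∧
      ∀ m, ∑ p ∈ Finset.HasAntidiagonal.antidiagonal m,
        (W p.1).comp (renewalCoeff O.Z p.2) = A m := by
  have hum : ∀ m s, AEStronglyMeasurable (fun y : S.Y => (w (S.T^[m] (y : X)) : ℂ))
      (S.μ.restrict s) := fun m s =>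
    (Complex.continuous_ofReal.comp_stronglyMeasurable
      (hw.comp_measurable (S.measurable_orbit m))).aestronglyMeasurable
  have hub : ∀ m, ∀ᵐ y : S.Y ∂S.μ, ‖(w (S.T^[m] (y : X)) : ℂ)‖ ≤ c := fun m => by
    filter_upwards [hc] with y hy
    rw [Complex.norm_real]
    exact hy m
  have hlp : ∀ m, MemLp (fun y : S.Y => (w (S.T^[m] (y : X)) : ℂ)) ⊤ S.μ := fun m =>
    memLp_top_of_bound (by simpa using hum m univ) c (hub m)
  choose W hW _ using fun m => E.exists_functional O.D_nonneg O.ae_norm_le hc0 (hum m univ)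
    (ae_restrict_of_ae (hub m))
  choose A hA hAn using fun m => E.exists_functional O.D_nonneg O.ae_norm_le hc0
    (hum m {y | m < S.φ y}) (ae_restrict_of_ae (hub m))
  simp only [Measure.restrict_univ] at hW
  refine ⟨W, A, hW, hA, hAn, fun m => ?_⟩
  ext b
  have hint : ∀ (u : S.Y → ℂ), MemLp u ⊤ S.μ → Integrable (fun y => E.toL1 b y * u y) S.μ :=
    fun u hu => (L1.integrable_coeFn (E.toL1 b)).mul_bdd hu.1 (by
      filter_upwards [ae_le_eLpNormEssSup (f := u) (μ := S.μ)] with y hy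
      have := ENNReal.toReal_mono hu.eLpNorm_ne_top (by simpa using hy)
      simpa using this)
  -- `q` interpolates between `q 0 = W m b` and `q m = A m b`; the convolution telescopes along it.
  set q : ℕ → ℂ := fun j =>
    ∫ y in {y | j < S.φ y}, E.toL1 b y * (w (S.T^[m] (y : X)) : ℂ) ∂S.μ with hq
  have hq0 : q 0 = W m b := by
    have hφ0 : {y | 0 < S.φ y} = univ := eq_univ_of_forall fun y => S.one_le_φ y
    simp only [hq, hφ0, Measure.restrict_univ, hW]
  have hstep : ∀ j < m, W (m - (j + 1)) (renewalCoeff O.Z (j + 1) b) = q (j + 1) - q j := by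
    intro j hj
    set u : S.Y → ℂ := fun y => (w (S.T^[m - (j + 1)] (y : X)) : ℂ) with hu
    have h1 : ∀ x, W (m - (j + 1)) x = ∫ y, E.toL1 x y * u y ∂S.μ := hW _
    rw [renewalCoeff, if_neg (Nat.succ_ne_zero j), Nat.add_sub_cancel, sub_apply, map_sub, h1, h1,
      O.integral_Z _ _ _ (hlp _), O.integral_Z _ _ _ (hlp _),
      S.setIntegral_lt_φ_eq_add (hint _ (S.memLp_comp_F (hlp _))) j]
    simp only [hq]
    rw [S.setIntegral_lt_φ_eq_add (hint _ (hlp m)) j]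
    -- On `{φ = j + 1}` following `F` and then `T^(m - j - 1)` amounts to `T^m`.
    have h2 : ∫ y in {y | S.φ y = j + 1}, E.toL1 b y * u (S.F y) ∂S.μ =
        ∫ y in {y | S.φ y = j + 1}, E.toL1 b y * (w (S.T^[m] (y : X)) : ℂ) ∂S.μ := by
      refine setIntegral_congr_fun (S.measurableSet_φ_eq _) fun y hy => ?_
      have hy' : S.φ y = j + 1 := hy
      simp only [hu]
      rw [S.iterate_eq_iterate_F (m := m) (by omega), hy']
    rw [h2]
    ring
  rw [Finset.Nat.sum_antidiagonal_eq_sum_range_succ_mk, sum_apply, ← Finset.sum_range_reflect]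
  simp only [Nat.succ_sub_one, ContinuousLinearMap.comp_apply]
  rw [Finset.sum_range_succ']
  have h0 : W (m - 0) (renewalCoeff O.Z (m - (m - 0)) b) = q 0 := by
    rw [hq0, Nat.sub_zero, Nat.sub_self]
    simp [renewalCoeff]
  rw [h0, Finset.sum_congr rfl (g := fun j => q (j + 1) - q j), Finset.sum_range_sub,
    sub_add_cancel, hA]
  intro j hj
  have hj' := Finset.mem_range.1 hj
  rw [← hstep j hj', show m - (m - (j + 1)) = j + 1 by omega]

/-- The classes `R(1_{φ > k} v ∘ T ^ (φ - k - 1))` and the decomposition of correlations that they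
give. -/
theorem exists_decomposition (O : S.RenewalOperators E) {v w : X → ℝ}
    (hvm : AEStronglyMeasurable v S.μX) (hv : S.Exchangeable E v)
    (hw : StronglyMeasurable w) {c : ℝ}
    (hc : ∀ᵐ y : S.Y ∂S.μ, ∀ m, ‖w (S.T^[m] (y : X))‖ ≤ c) :
    ∃ b : ℕ → B, (∀ k, ‖b k‖ ≤ O.C * S.exNorm E v * S.tail k) ∧
      (∀ k, ‖O.ι (b k)‖ ≤ O.D * S.exNorm E v * S.tail k) ∧
      HasSum (fun k => O.ι (b k)) ((S.meanφ * ∫ x, v x ∂S.μX : ℝ) : ℂ) ∧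
      ∀ n, ‖∑ k ∈ Finset.range n,
          (∫ y, E.toL1 (b k) y * (w (S.T^[n - 1 - k] (y : X)) : ℂ) ∂S.μ) -
        ((S.meanφ * ∫ x, v x * w (S.T^[n] x) ∂S.μX : ℝ) : ℂ)‖ ≤
          O.D * S.exNorm E v * c * S.tailSum n := by
  have hV0 := hv.exNorm_nonneg S
  have hvb := hv.ae_norm_le S O
  set V := S.exNorm E v
  choose b hb hbn using hv.exists_class S
  have hvt : ∀ k, (fun y => (v (S.T^[S.φ y - 1 - k] (y : X)) : ℂ)) =ᵐ[S.μ.restrict {y | k < S.φ y}]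
      E.toL1 (b k) := fun k => by
    rw [Filter.EventuallyEq, ae_restrict_iff' (S.measurableSet_lt_φ k)]
    filter_upwards [hb k] with y hy hk
    have hk' : k < S.φ y := hk
    rw [hy, derivedFromTop, if_pos hk']
  have hvtm : ∀ k, AEStronglyMeasurable (fun y => (v (S.T^[S.φ y - 1 - k] (y : X)) : ℂ))
      (S.μ.restrict {y | k < S.φ y}) := fun k =>
    ((L1.integrable_coeFn (E.toL1 (b k))).aestronglyMeasurable.restrict).congr (hvt k).symm
  -- the mean of `v`
  have hmeanv : HasSum (fun k => O.ι (O.Z k (b k))) ((S.meanφ * ∫ x, v x ∂S.μX : ℝ) : ℂ) ∧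
      ∀ k, ‖O.ι (O.Z k (b k))‖ ≤ O.D * V * S.tail k := by
    have hι : ∀ k, O.ι (O.Z k (b k)) =
        ∫ y in {y | k < S.φ y}, (v (S.T^[S.φ y - 1 - k] (y : X)) : ℂ) ∂S.μ := fun k => by
      have h1 := O.integral_Z k (b k) (fun _ => 1) (memLp_const _)
      simp only [mul_one] at h1
      rw [O.ι_apply, h1]
      exact (integral_congr_ae (hvt k)).symm
    have hbd : ∀ᵐ y ∂S.μ, ∀ k < S.φ y, ‖(v (S.T^[S.φ y - 1 - k] (y : X)) : ℂ)‖ ≤ O.D * V := by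
      filter_upwards [hvb] with y hy k hk
      rw [Complex.norm_real]
      exact hy _ (by omega)
    have h1 := (S.hasSum_setIntegral_tower hvtm hbd).2
    simp only [hι]
    constructor
    · have h2 : ((S.meanφ * ∫ x, v x ∂S.μX : ℝ) : ℂ) = ∫ y, ∑ k ∈ Finset.range (S.φ y),
          (v (S.T^[S.φ y - 1 - k] (y : X)) : ℂ) ∂S.μ := by
        rw [S.integral_μX hvm hvb, ← integral_complex_ofReal]
        refine integral_congr_ae (ae_of_all _ fun y => ?_)
        simp only
        rw [← Finset.sum_range_reflect]
        push_cast
        rfl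
      rw [h2]
      exact h1
    · intro k
      refine norm_setIntegral_le_of_norm_le_const_ae' (C := O.D * V) (measure_lt_top _ _) ?_
      filter_upwards [hbd] with y hy hk using hy k hk
  refine ⟨fun k => O.Z k (b k), fun k => ?_, hmeanv.2, hmeanv.1, fun n => ?_⟩
  · refine (ContinuousLinearMap.le_opNorm _ _).trans ?_
    have := O.norm_Z_le k
    have := O.C_nonneg
    have := S.tail_nonneg k
    calc ‖O.Z k‖ * ‖b k‖ ≤ O.C * S.tail k * V := by gcongr; exact hbn k
      _ = O.C * V * S.tail k := by ring
  · set f : ℕ → S.Y → ℂ := fun k y => (v (S.T^[S.φ y - 1 - k] (y : X)) : ℂ) *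
      (w (S.T^[n + (S.φ y - 1 - k)] (y : X)) : ℂ) with hf
    have hwm : ∀ k, Measurable fun y => (w (S.T^[n + (S.φ y - 1 - k)] (y : X)) : ℂ) := fun k => by
      have h1 : Measurable fun p : S.Y × ℕ => (w (S.T^[n + (p.2 - 1 - k)] (p.1 : X)) : ℂ) :=
        measurable_from_prod_countable_left fun ℓ =>
          Complex.measurable_ofReal.comp
            (hw.measurable.comp (S.measurable_orbit (n + (ℓ - 1 - k))))
      exact h1.comp (measurable_id.prodMk S.measurable_φ)
    have hfm : ∀ k, AEStronglyMeasurable (f k) (S.μ.restrict {y | k < S.φ y}) := fun k =>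
      (hvtm k).mul (hwm k).aestronglyMeasurable
    have hfb : ∀ᵐ y ∂S.μ, ∀ k < S.φ y, ‖f k y‖ ≤ O.D * V * c := by
      filter_upwards [hvb, hc] with y hy1 hy2 k hk
      rw [hf, norm_mul, Complex.norm_real, Complex.norm_real]
      have h1 := hy1 (S.φ y - 1 - k) (by omega)
      exact mul_le_mul h1 (hy2 _) (norm_nonneg _) ((norm_nonneg _).trans h1)
    have h1 := (S.hasSum_setIntegral_tower hfm hfb).2
    have hmean : ∫ y, ∑ k ∈ Finset.range (S.φ y), f k y ∂S.μ =
        ((S.meanφ * ∫ x, v x * w (S.T^[n] x) ∂S.μX : ℝ) : ℂ) := by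
      have h2 : AEStronglyMeasurable (fun x => v x * w (S.T^[n] x)) S.μX :=
        hvm.mul (hw.comp_measurable (S.measurable_T.iterate n)).aestronglyMeasurable
      rw [S.integral_μX (c := O.D * V * c) h2, ← integral_complex_ofReal]
      · refine integral_congr_ae (ae_of_all _ fun y => ?_)
        symm
        simp only
        rw [← Finset.sum_range_reflect]
        push_cast
        simp only [hf, Function.iterate_add_apply]
      · filter_upwards [hvb, hc] with y hy1 hy2 ℓ hℓ
        rw [norm_mul, ← Function.iterate_add_apply]
        exact mul_le_mul (hy1 ℓ hℓ) (hy2 _) (norm_nonneg _) ((norm_nonneg _).trans (hy1 ℓ hℓ))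
    rw [hmean] at h1
    refine le_trans (le_of_eq ?_) (S.norm_sum_range_sub_le h1 (c := O.D * V * c) (fun k => ?_) n)
    · congr 2
      refine Finset.sum_congr rfl fun k hk => ?_
      have hk' := Finset.mem_range.1 hk
      have hlp : MemLp (fun y : S.Y => (w (S.T^[n - 1 - k] (y : X)) : ℂ)) ⊤ S.μ := by
        refine memLp_top_of_bound (Complex.continuous_ofReal.comp_stronglyMeasurable
          (hw.comp_measurable (S.measurable_orbit _))).aestronglyMeasurable c ?_
        filter_upwards [hc] with y hy
        rw [Complex.norm_real]
        exact hy _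
      rw [O.integral_Z _ _ _ hlp]
      refine integral_congr_ae ?_
      filter_upwards [hvt k, ae_restrict_mem (S.measurableSet_lt_φ k)] with y hy hky
      have hky' : k < S.φ y := hky
      rw [← hy]
      simp only [hf]
      -- For `k < n` the orbit passes through `F y`, and the remaining time `n - 1 - k` no longer
      -- depends on `φ y`.
      rw [S.iterate_eq_iterate_F (m := n + (S.φ y - 1 - k)) (by omega)]
      congr 4
      omega
    · refine norm_setIntegral_le_of_norm_le_const_ae' (C := O.D * V * c) (measure_lt_top _ _) ?_
      filter_upwards [hfb] with y hy hk using hy k hk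

end InducingScheme

/-! ### The correlation estimate at a fixed time -/

namespace InducingScheme

variable {X : Type*} [MeasurableSpace X] (S : InducingScheme X)
  {B : Type*} [NormedAddCommGroup B] [NormedSpace ℂ B] {E : ObservableSpace S.μ B}

namespace RenewalOperators

variable {S} (O : S.RenewalOperators E)

/-- The projection `b ↦ (∫ b dμ) 1`. -/
noncomputable def P : B →L[ℂ] B := O.ι.smulRight O.e

theorem ι_Z (j : ℕ) (b : B) : O.ι (O.Z j b) = ∫ y in {y | j < S.φ y}, E.toL1 b y ∂S.μ := by
  have := O.integral_Z j b (fun _ => 1) (memLp_const _)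
  simpa [O.ι_apply] using this

theorem ι_Z_zero (b : B) : O.ι (O.Z 0 b) = O.ι b := by
  have hφ0 : {y | 0 < S.φ y} = univ := eq_univ_of_forall fun y => S.one_le_φ y
  rw [ι_Z, hφ0, Measure.restrict_univ, O.ι_apply]

theorem ι_Z_e (j : ℕ) : O.ι (O.Z j O.e) = S.tail j := by
  rw [ι_Z, setIntegral_congr_ae (g := fun _ => (1 : ℂ)) (S.measurableSet_lt_φ j)
    (O.toL1_e.mono fun y hy _ => hy)]
  simp [tail]

/-- The residue at `1` of the truncated resolvent. -/
theorem P_inverse_apply {n : ℕ}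
    (h : IsUnit (regularized (O.Z 0) O.P (truncSeries O.Z n 1) 1)) (x : B) :
    O.P (Ring.inverse (regularized (O.Z 0) O.P (truncSeries O.Z n 1) 1) x) =
      (O.ι x / ((∑ j ∈ Finset.range (n + 1), S.tail j : ℝ) : ℂ)) • O.e := by
  set y := Ring.inverse (regularized (O.Z 0) O.P (truncSeries O.Z n 1) 1) x with hy
  have h1 : regularized (O.Z 0) O.P (truncSeries O.Z n 1) 1 y = x := by
    have := congrArg (fun L : B →L[ℂ] B => L x) (Ring.mul_inverse_cancel _ h)
    simpa using this
  have h2 : O.ι (truncSeries O.Z n 1 O.e) = ((∑ j ∈ Finset.range (n + 1), S.tail j : ℝ) : ℂ) := by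
    simp [truncSeries, O.ι_Z_e]
  have h3 : O.ι x = O.ι y * ((∑ j ∈ Finset.range (n + 1), S.tail j : ℝ) : ℂ) := by
    -- Apply `ι` to `K(1) y = x`: the part through `1 - Z 0` is killed, and `V P` contributes `ι y`
    -- times the truncated mean return time.
    rw [← h1, ← h2]
    simp [regularized, poleFactor, P, O.ι_Z_zero]
  have h4 : (1 : ℝ) ≤ ∑ j ∈ Finset.range (n + 1), S.tail j := by
    rw [← S.tail_zero]
    exact Finset.single_le_sum (fun j _ => S.tail_nonneg j) (by simp)
  rw [h3, mul_div_cancel_right₀ _ (by exact_mod_cast (by linarith)), P]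
  rfl

end RenewalOperators

/-- The correlation estimate at a fixed time, in terms of the truncated operators on a disc of
radius `r > 1`. -/
theorem abs_corr_le [CompleteSpace B] (O : S.RenewalOperators E) {n : ℕ} {r M κ : ℝ} (hr : 1 < r)
    (hr2 : r ≤ 2)
    (hK : ∀ z : ℂ, ‖z‖ ≤ r → IsUnit (regularized (O.Z 0) O.P (truncSeries O.Z n z) z) ∧
      ‖Ring.inverse (regularized (O.Z 0) O.P (truncSeries O.Z n z) z)‖ ≤ M)
    (hκ : ∑ j ∈ Finset.range (n + 1), S.tail j * r ^ j ≤ κ) {v w : X → ℝ}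
    (hvm : AEStronglyMeasurable v S.μX) (hv : S.Exchangeable E v)
    (hw : StronglyMeasurable w) {c : ℝ} (hc0 : 0 ≤ c) (hc : ∀ᵐ x ∂S.μX, ‖w x‖ ≤ c) :
    |S.corr v w n| ≤ (O.D * κ * ((‖O.P‖ + 3 * (1 + ‖O.P‖)) * (M * (2 * (O.C * κ)))) * ((r ^ n)⁻¹ *
        ∫ θ in (0 : ℝ)..2 * Real.pi, ‖1 - circleMap 0 r θ‖⁻¹) +
      (3 * S.meanφ + 1) * O.D * S.tailSum n) * (S.exNorm E v * c) := by
  have hr0 : 0 < r := zero_lt_one.trans hr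
  have hV0 := hv.exNorm_nonneg S
  have hD0 := O.D_nonneg
  have hC0 := O.C_nonneg
  have hcY := S.ae_forall_iterate hc
  obtain ⟨W, A, hW, hA, hAn, hren⟩ := S.exists_renewal_functionals O hw hc0 hcY
  obtain ⟨b, hbn, hιb, hιbsum, hdec⟩ := S.exists_decomposition O hvm hv hw hcY
  set V := S.exNorm E v
  have hκ0 : 0 ≤ κ := le_trans (Finset.sum_nonneg fun j _ =>
    mul_nonneg (S.tail_nonneg j) (by positivity)) hκ
  -- The indices `n - 1 - k` and `k` add up to `n - 1`; shifting `b` by one turns the sum into the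
  -- `n`-th coefficient, at the cost of a factor `r ≤ 2`.
  set b' : ℕ → B := fun k => if k = 0 then 0 else b (k - 1) with hb'
  have hA' : ∀ z : ℂ, ‖z‖ = r → ‖truncSeries A n z‖ ≤ O.D * c * κ := fun z hz => by
    refine (norm_truncSeries_le A n z).trans ?_
    calc ∑ m ∈ Finset.range (n + 1), ‖z‖ ^ m * ‖A m‖
        ≤ ∑ m ∈ Finset.range (n + 1), O.D * c * (S.tail m * r ^ m) :=
          Finset.sum_le_sum fun m _ => by
            rw [hz]
            calc r ^ m * ‖A m‖ ≤ r ^ m * (O.D * c * S.tail m) := by gcongr; exact hAn m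
              _ = _ := by ring
      _ ≤ O.D * c * κ := by rw [← Finset.mul_sum]; gcongr
  have hb'n : ∀ z : ℂ, ‖z‖ = r → ‖truncSeries b' n z‖ ≤ 2 * (O.C * V * κ) := fun z hz => by
    refine (norm_truncSeries_le b' n z).trans ?_
    rw [Finset.sum_range_succ']
    simp only [hb', if_true, norm_zero, mul_zero, add_zero, Nat.succ_ne_zero, if_false,
      Nat.add_sub_cancel]
    calc ∑ m ∈ Finset.range n, ‖z‖ ^ (m + 1) * ‖b m‖
        ≤ ∑ m ∈ Finset.range n, 2 * (O.C * V) * (S.tail m * r ^ m) :=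
          Finset.sum_le_sum fun m _ => by
            have := S.tail_nonneg m
            rw [hz, pow_succ]
            calc r ^ m * r * ‖b m‖ ≤ r ^ m * 2 * (O.C * V * S.tail m) := by gcongr; exact hbn m
              _ = _ := by ring
      _ ≤ ∑ m ∈ Finset.range (n + 1), 2 * (O.C * V) * (S.tail m * r ^ m) := by
          rw [Finset.sum_range_succ]
          have := S.tail_nonneg n
          exact le_add_of_nonneg_right (by positivity)
      _ ≤ 2 * (O.C * V * κ) := by
          rw [← Finset.mul_sum, mul_assoc]
          gcongr
  have hcontour := norm_renewal_sub_residue_le n hr hr2 O.Z (P := O.P) O.sub_mul_eq_zero W A b'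
    (fun m _ => hren m) hK hA' hb'n
  -- the coefficient
  set F : ℂ := ∑ p ∈ Finset.HasAntidiagonal.antidiagonal n, W p.1 (b' p.2) with hF
  have hFeq : F = ∑ k ∈ Finset.range n,
      (∫ y, E.toL1 (b k) y * (w (S.T^[n - 1 - k] (y : X)) : ℂ) ∂S.μ) := by
    rw [hF, Finset.Nat.sum_antidiagonal_eq_sum_range_succ_mk, ← Finset.sum_range_reflect,
      Finset.sum_range_succ']
    have h0 : W (n.succ - 1 - 0) (b' (n - (n.succ - 1 - 0))) = 0 := by simp [hb']
    simp only [h0, add_zero]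
    refine Finset.sum_congr rfl fun k hk => ?_
    have hk' := Finset.mem_range.1 hk
    rw [← hW, show n.succ - 1 - (k + 1) = n - 1 - k by omega, show n - (n - 1 - k) = k + 1 by omega]
    simp [hb']
  -- the residue
  set t : ℝ := ∑ j ∈ Finset.range (n + 1), S.tail j with ht
  set a : ℂ := ∑ m ∈ Finset.range (n + 1), A m O.e with ha
  set β : ℂ := ∑ k ∈ Finset.range n, O.ι (b k) with hβ
  have hres : truncSeries A n 1 (O.P (Ring.inverse
      (regularized (O.Z 0) O.P (truncSeries O.Z n 1) 1) (truncSeries b' n 1))) = a * β / t := by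
    rw [O.P_inverse_apply (hK 1 (by simpa using hr.le)).1, map_smul, smul_eq_mul]
    have h1 : truncSeries A n 1 O.e = a := by simp [truncSeries, ha]
    have h2 : O.ι (truncSeries b' n 1) = β := by
      rw [truncSeries, Finset.sum_range_succ']
      simp [hb', hβ]
    rw [h1, h2]
    ring
  rw [hres] at hcontour
  -- the leading term
  have hAe : ∀ m, A m O.e = ∫ y in {y | m < S.φ y}, (w (S.T^[m] (y : X)) : ℂ) ∂S.μ := fun m => by
    rw [hA]
    refine setIntegral_congr_ae (S.measurableSet_lt_φ m) ?_
    filter_upwards [O.toL1_e] with y hy _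
    rw [hy, one_mul]
  have hAen : ∀ m, ‖A m O.e‖ ≤ c * S.tail m := fun m => by
    rw [hAe]
    refine norm_setIntegral_le_of_norm_le_const_ae' (measure_lt_top _ _) ?_
    filter_upwards [hcY] with y hy _
    rw [Complex.norm_real]
    exact hy m
  have hwsum : HasSum (fun m => A m O.e) ((S.meanφ * ∫ x, w x ∂S.μX : ℝ) : ℂ) := by
    have h1 := (S.hasSum_setIntegral_tower
      (f := fun m (y : S.Y) => (w (S.T^[m] (y : X)) : ℂ)) (c := c)
      (fun m => (Complex.continuous_ofReal.comp_stronglyMeasurable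
        (hw.comp_measurable (S.measurable_orbit m))).aestronglyMeasurable)
      (by
        filter_upwards [hcY] with y hy m _
        rw [Complex.norm_real]
        exact hy m)).2
    simp only [← hAe] at h1
    have h2 : ((S.meanφ * ∫ x, w x ∂S.μX : ℝ) : ℂ) = ∫ y, ∑ m ∈ Finset.range (S.φ y),
        (w (S.T^[m] (y : X)) : ℂ) ∂S.μ := by
      rw [S.integral_μX hw.aestronglyMeasurable (S.ae_μX_imp hc), ← integral_complex_ofReal]
      simp only [Complex.ofReal_sum]
    rw [h2]
    exact h1
  have htn : 1 ≤ t := by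
    rw [← S.tail_zero]
    exact Finset.single_le_sum (fun j _ => S.tail_nonneg j) (by simp)
  have hsucc : S.tailSum (n + 1) ≤ S.tailSum n := by
    rw [S.tailSum_succ n]
    exact le_add_of_nonneg_left (S.tail_nonneg n)
  have hbound : ∀ {f : ℕ → ℂ} {x : ℂ} {d : ℝ}, HasSum f x → (∀ k, ‖f k‖ ≤ d * S.tail k) →
      ‖x‖ ≤ d * S.meanφ := fun {f x d} hf hd => by
    rw [← hf.tsum_eq]
    exact tsum_of_norm_bounded (S.hasSum_tail.mul_left d) hd
  have hlead := norm_mul_div_sub_le (a := a) (b := β) (t := t) (t₀ := S.meanφ) (c := c)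
    (d := O.D * V) (σ := S.tailSum n) hc0 (by positivity) htn S.one_le_meanφ
    (by
      refine (norm_sum_le_of_le _ fun k _ => hιb k).trans ?_
      rw [← Finset.mul_sum]
      gcongr
      exact sum_le_hasSum _ (fun j _ => S.tail_nonneg j) S.hasSum_tail)
    (hbound hwsum hAen) (hbound hιbsum hιb)
    ((S.norm_sum_range_sub_le hwsum hAen (n + 1)).trans (by gcongr))
    (S.norm_sum_range_sub_le hιbsum hιb n)
    (by
      have := S.norm_sum_range_sub_le S.hasSum_tail (c := 1) (fun j => by
        rw [Real.norm_of_nonneg (S.tail_nonneg j), one_mul]) (n + 1)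
      rw [one_mul] at this
      exact this.trans hsucc)
  -- conclusion
  have hdecn := hdec n
  rw [← hFeq] at hdecn
  have hmean := S.meanφ_pos
  -- Three errors: truncation of the product of means, the contour integral, and the levels that
  -- have not returned by time `n`.
  have hid : ((S.meanφ * S.corr v w n : ℝ) : ℂ) =
      (a * β / t - ((S.meanφ * ∫ x, w x ∂S.μX : ℝ) : ℂ) * ((S.meanφ * ∫ x, v x ∂S.μX : ℝ) : ℂ) /
        (S.meanφ : ℂ)) + (F - a * β / t) -
      (F - ((S.meanφ * ∫ x, v x * w (S.T^[n] x) ∂S.μX : ℝ) : ℂ)) := by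
    have : (S.meanφ : ℂ) ≠ 0 := by exact_mod_cast hmean.ne'
    rw [corr]
    push_cast
    field_simp
    ring
  have hfin : |S.corr v w n| ≤ ‖((S.meanφ * S.corr v w n : ℝ) : ℂ)‖ := by
    rw [Complex.norm_real, Real.norm_eq_abs, abs_mul, abs_of_pos hmean]
    exact le_mul_of_one_le_left (abs_nonneg _) S.one_le_meanφ
  refine hfin.trans ?_
  rw [hid]
  refine (norm_sub_le _ _).trans ((add_le_add ((norm_add_le _ _).trans
    (add_le_add hlead hcontour)) hdecn).trans_eq ?_)
  ring

end InducingScheme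

/-! ### From fixed times to uniform bounds -/

namespace InducingScheme

variable {X : Type*} [MeasurableSpace X] (S : InducingScheme X)
  {B : Type*} [NormedAddCommGroup B] [NormedSpace ℂ B] {E : ObservableSpace S.μ B}

theorem exists_stronglyMeasurable_version {w : X → ℝ} (hw : MemLp w ⊤ S.μX) :
    ∃ w' : X → ℝ, StronglyMeasurable w' ∧ (∀ v n, S.corr v w n = S.corr v w' n) ∧
      ∀ᵐ x ∂S.μX, ‖w' x‖ ≤ (eLpNorm w ⊤ S.μX).toReal := by
  refine ⟨hw.1.mk w, hw.1.stronglyMeasurable_mk, fun v n => S.corr_congr v hw.1.ae_eq_mk n, ?_⟩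
  filter_upwards [ae_le_eLpNormEssSup (f := w) (μ := S.μX), hw.1.ae_eq_mk] with x hx hx'
  rw [← hx']
  have := ENNReal.toReal_mono hw.eLpNorm_ne_top (by simpa using hx)
  simpa using this

/-- The trivial bound, for the finitely many times not covered by the asymptotic estimate. -/
theorem abs_corr_le_two_mul (O : S.RenewalOperators E) {v w : X → ℝ}
    (hvm : AEStronglyMeasurable v S.μX) (hv : S.Exchangeable E v)
    (hw : StronglyMeasurable w) {c : ℝ} (hc : ∀ᵐ x ∂S.μX, ‖w x‖ ≤ c) (n : ℕ) :
    |S.corr v w n| ≤ 2 * O.D * (S.exNorm E v * c) := by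
  have hvb := hv.ae_norm_le S O
  have hcY := S.ae_forall_iterate hc
  have hV := hv.exNorm_nonneg S
  have hD := O.D_nonneg
  have h1 : ‖∫ x, v x * w (S.T^[n] x) ∂S.μX‖ ≤ O.D * S.exNorm E v * c := by
    refine S.norm_integral_μX_le (h := fun x => v x * w (S.T^[n] x))
      (hvm.mul (hw.comp_measurable (S.measurable_T.iterate n)).aestronglyMeasurable) ?_
    filter_upwards [hvb, hcY] with y hy1 hy2 ℓ hℓ
    rw [norm_mul, ← Function.iterate_add_apply]
    exact mul_le_mul (hy1 ℓ hℓ) (hy2 _) (norm_nonneg _) (by positivity)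
  have h2 := S.norm_integral_μX_le hvm hvb
  have h3 := S.norm_integral_μX_le hw.aestronglyMeasurable (S.ae_μX_imp hc)
  rw [corr, ← Real.norm_eq_abs]
  refine (norm_sub_le _ _).trans ?_
  rw [norm_mul]
  have h4 := mul_le_mul h2 h3 (norm_nonneg _) (by positivity)
  linarith

/-- The threshold is independent of the observables, so finitely many early times can be absorbed in
the constant; positivity of `a` is what permits this. -/
theorem corrDominated_of_eventually (O : S.RenewalOperators E) {a : ℕ → ℝ}
    (ha : ∀ n, 1 ≤ n → 0 < a n) {K : ℝ} (hK : 0 ≤ K)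
    (h : ∀ᶠ n in atTop, ∀ v w : X → ℝ, ∀ c : ℝ, AEStronglyMeasurable v S.μX → S.Exchangeable E v →
      StronglyMeasurable w → 0 ≤ c → (∀ᵐ x ∂S.μX, ‖w x‖ ≤ c) →
        |S.corr v w n| ≤ K * a n * (S.exNorm E v * c)) : S.CorrDominated E a := by
  obtain ⟨N, hN⟩ := eventually_atTop.1 h
  have hD := O.D_nonneg
  set K' := ∑ n ∈ Finset.range N, 2 * O.D * |a n|⁻¹ with hK'
  refine ⟨K + K', fun v w hv hex hw n hn => ?_⟩
  obtain ⟨w', hw', hcorr, hb⟩ := S.exists_stronglyMeasurable_version hw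
  rw [hcorr]
  set c := (eLpNorm w ⊤ S.μX).toReal
  have hc : 0 ≤ c := ENNReal.toReal_nonneg
  have hV := hex.exNorm_nonneg S
  have han := ha n hn
  have hK'0 : 0 ≤ K' := Finset.sum_nonneg fun _ _ => by positivity
  have hgoal : (K + K') * S.exNorm E v * c * a n = (K + K') * a n * (S.exNorm E v * c) := by ring
  rw [hgoal]
  by_cases hnN : N ≤ n
  · refine (hN n hnN v w' c hv.1 hex hw' hc hb).trans ?_
    gcongr
    linarith
  · refine (S.abs_corr_le_two_mul O hv.1 hex hw' hb n).trans ?_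
    have h1 : 2 * O.D * |a n|⁻¹ ≤ K' :=
      Finset.single_le_sum (f := fun n => 2 * O.D * |a n|⁻¹) (fun _ _ => by positivity)
        (Finset.mem_range.2 (not_le.1 hnN))
    have h2 : 2 * O.D = 2 * O.D * |a n|⁻¹ * a n := by
      rw [abs_of_pos han, inv_mul_cancel_right₀ han.ne']
    rw [h2]
    gcongr
    linarith

variable {S} in
theorem CorrDominated.mono {a b : ℕ → ℝ} (h : S.CorrDominated E a) {K : ℝ}
    (ha : ∀ n, 1 ≤ n → 0 ≤ a n) (hab : ∀ n, 1 ≤ n → a n ≤ K * b n) : S.CorrDominated E b := by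
  obtain ⟨C, hC⟩ := h
  refine ⟨|C| * K, fun v w hv hex hw n hn => (hC v w hv hex hw n hn).trans ?_⟩
  have hV := hex.exNorm_nonneg S
  have h1 := ha n hn
  calc C * S.exNorm E v * (eLpNorm w ⊤ S.μX).toReal * a n
      ≤ |C| * S.exNorm E v * (eLpNorm w ⊤ S.μX).toReal * (K * b n) := by
        gcongr
        · exact le_abs_self C
        · exact hab n hn
    _ = _ := by ring

theorem corrDominated_of_tail_dominated [CompleteSpace B] (hS : S.IsExcellent E)
    (hB : E.EmbedsInLinfty) {g : ℕ → ℝ} (hg : MonotoneOn g (Ici 1))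
    (hgO : ∃ δ : ℝ, 0 < δ ∧ Dominated g (fun n => (n : ℝ) ^ (1 - δ))) {η : ℝ} (hη : 0 < η)
    {k₀ : ℕ} (hanti : AntitoneOn (fun k : ℕ => (g k - (1 + η) * Real.log k) / k) (Ici k₀))
    (hτ : Dominated S.tail fun n => Real.exp (-g n)) {ε : ℝ} (hε : 0 < ε) :
    S.CorrDominated E
      (fun n => (n : ℝ) ^ (1 + ε) * Real.exp (-g n) + ∑' j : ℕ, S.tail (n + 1 + j)) := by
  obtain ⟨O⟩ := hS.nonempty_renewalOperators S hB
  obtain ⟨ρ, bound, s, C, hbound, hs0, hs1, hρ1, hρ, hρb, hρC⟩ :=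
    exists_radii hg hgO hη hanti S.tail_nonneg hτ hε
  obtain ⟨C', hC'0, hC'⟩ := exists_integral_inv_norm_one_sub_le hs0 hs1
  have hC0 := O.C_nonneg
  have hD0 := O.D_nonneg
  obtain ⟨M, hM⟩ := exists_uniform_norm_inverse_le (Z := O.Z) (P := O.P)
    (Summable.of_nonneg_of_le (fun _ => norm_nonneg _) O.norm_Z_le (S.summable_tail.mul_left O.C))
    O.isUnit_regularized (hρ1.mono fun _ h => h.le) hρ (hbound.mul_left O.C) (by
      filter_upwards [hρb, hρ1] with n hn hn1 j hj
      have : 0 ≤ ρ n ^ j := pow_nonneg (by linarith) _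
      calc ‖O.Z j‖ * ρ n ^ j ≤ O.C * S.tail j * ρ n ^ j := by gcongr; exact O.norm_Z_le j
        _ = O.C * (S.tail j * ρ n ^ j) := by ring
        _ ≤ _ := mul_le_mul_of_nonneg_left (hn j hj) hC0)
  obtain ⟨K, hK⟩ := hτ
  set κ := ∑' j, |bound j| with hκ
  have hκ0 : 0 ≤ κ := tsum_nonneg fun _ => abs_nonneg _
  set K₁ := O.D * κ * ((‖O.P‖ + 3 * (1 + ‖O.P‖)) * (|M| * (2 * (O.C * κ)))) with hK₁
  have hK₁0 : 0 ≤ K₁ := by positivity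
  set K₂ := (3 * S.meanφ + 1) * O.D with hK₂
  have hmean := S.meanφ_pos
  have hK₂0 : 0 ≤ K₂ := by positivity
  refine S.corrDominated_of_eventually O (K := K₁ * (C' * |C|) + K₂ * (|K| + 1)) (fun n hn => ?_)
    (by positivity) ?_
  · have hn0 : (0 : ℝ) < n := by exact_mod_cast hn
    have := S.tailSum_nonneg (n + 1)
    exact add_pos_of_pos_of_nonneg (by positivity) this
  · filter_upwards [hρ1, hρ.eventually_le_const one_lt_two, hρb, hρC, hM, eventually_ge_atTop 1]
      with n hn1 hn2 hnb hnC hnM hn v w c hvm hv hw hc0 hc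
    have hV := hv.exNorm_nonneg S
    have h1 := S.abs_corr_le O (M := |M|) (κ := κ) hn1 hn2
      (fun z hz => ⟨(hnM z hz).1, (hnM z hz).2.trans (le_abs_self M)⟩)
      ((Finset.sum_le_sum fun j hj => (hnb j (Nat.lt_succ_iff.1 (Finset.mem_range.1 hj))).trans
        (le_abs_self _)).trans (hbound.abs.sum_le_tsum _ fun _ _ => abs_nonneg _))
      hvm hv hw hc0 hc
    refine h1.trans (mul_le_mul_of_nonneg_right ?_ (by positivity))
    set q := (n : ℝ) ^ (1 + ε) * Real.exp (-g n) with hq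
    have hn1' : (1 : ℝ) ≤ n := by exact_mod_cast hn
    have hq0 : 0 ≤ q := by positivity
    have hρn : 0 ≤ (ρ n ^ n)⁻¹ := inv_nonneg.2 (pow_nonneg (by linarith) _)
    have h2 : (ρ n ^ n)⁻¹ * ∫ θ in (0 : ℝ)..2 * Real.pi, ‖1 - circleMap 0 (ρ n) θ‖⁻¹ ≤
        C' * |C| * q := by
      calc _ ≤ (ρ n ^ n)⁻¹ * (C' * (ρ n - 1) ^ (-s)) := by gcongr; exact hC' _ hn1
        _ = C' * ((ρ n ^ n)⁻¹ * (ρ n - 1) ^ (-s)) := by ring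
        _ ≤ C' * (|C| * q) := by
          exact mul_le_mul_of_nonneg_left
            (hnC.trans (mul_le_mul_of_nonneg_right (le_abs_self C) hq0)) hC'0
        _ = _ := by ring
    -- The errors involve `∑_{j ≥ n}`, the claim only `∑_{j > n}`; the extra term `μ(φ > n)` is
    -- absorbed by `q`.
    have h3 : S.tail n ≤ |K| * q := by
      refine (hK n hn).trans ?_
      have : Real.exp (-g n) ≤ q :=
        le_mul_of_one_le_left (Real.exp_pos _).le (Real.one_le_rpow hn1' (by linarith))
      exact mul_le_mul (le_abs_self K) this (Real.exp_pos _).le (abs_nonneg _)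
    have h4 := S.tailSum_nonneg (n + 1)
    rw [S.tailSum_succ n]
    change _ ≤ (K₁ * (C' * |C|) + K₂ * (|K| + 1)) * (q + S.tailSum (n + 1))
    calc _ ≤ K₁ * (C' * |C| * q) + K₂ * (|K| * q + S.tailSum (n + 1)) := by gcongr
      _ ≤ _ := by
        have e1 : 0 ≤ K₁ * (C' * |C|) * S.tailSum (n + 1) := by positivity
        have e2 : 0 ≤ K₂ * q := by positivity
        have e3 : 0 ≤ K₂ * |K| * S.tailSum (n + 1) := by positivity
        linarith

theorem corrDominated_of_tsum_dominated [CompleteSpace B] (hS : S.IsExcellent E)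
    (hB : E.EmbedsInLinfty) {g : ℕ → ℝ} (hg : MonotoneOn g (Ici 1))
    (hgO : ∃ δ : ℝ, 0 < δ ∧ Dominated g (fun n => (n : ℝ) ^ (1 - δ))) {η : ℝ} (hη : 0 < η)
    {k₀ : ℕ} (hanti : AntitoneOn (fun k : ℕ => (g k - (1 + η) * Real.log k) / k) (Ici k₀))
    (hτ : Dominated S.tail fun n => Real.exp (-g n)) {ε : ℝ} (hε : 0 < ε)
    (hsum : Dominated (fun n => ∑' j : ℕ, Real.exp (-g (n + 1 + j)))
      (fun n => (n : ℝ) ^ (1 + ε) * Real.exp (-g n))) :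
    S.CorrDominated E (fun n => (n : ℝ) ^ (1 + ε) * Real.exp (-g n)) := by
  have h := S.corrDominated_of_tail_dominated hS hB hg hgO hη hanti hτ hε
  obtain ⟨K, hK⟩ := hτ
  obtain ⟨K', hK'⟩ := hsum
  -- Summability is essential to the comparison: the `tsum` of a divergent series would be `0`.
  have hexp := summable_exp_neg_of_antitoneOn hg hη hanti
  refine h.mono (K := 1 + |K| * K')
    (fun n hn => add_nonneg (by positivity) (S.tailSum_nonneg (n + 1))) fun n hn => ?_
  have hshift : ∀ {f : ℕ → ℝ}, Summable f → Summable fun j => f (n + 1 + j) := fun {f} hf => by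
    simpa only [add_comm (n + 1)] using (summable_nat_add_iff (n + 1)).2 hf
  have h1 : ∑' j : ℕ, S.tail (n + 1 + j) ≤ |K| * ∑' j : ℕ, Real.exp (-g (n + 1 + j)) := by
    rw [← tsum_mul_left]
    refine (hshift S.summable_tail).tsum_le_tsum (fun j => ?_) ((hshift hexp).mul_left _)
    exact (hK _ (by omega)).trans
      (mul_le_mul_of_nonneg_right (le_abs_self K) (Real.exp_pos _).le)
  have h2 := mul_le_mul_of_nonneg_left (hK' n hn) (abs_nonneg K)
  simp only at h2
  linarith

end InducingScheme

/-! ### Stretched exponentials -/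

/-- The numerator of the derivative is `-c (1 - γ) x^γ - 2 + 2 log x`, negative once `log x ≤ c (1 -
γ) x^γ / 2`. The form `1 + 1` is `1 + η` with `η = 1`. -/
theorem exists_antitoneOn_stretched {c γ : ℝ} (hc : 0 < c) (hγ : 0 < γ) (hγ1 : γ < 1) :
    ∃ k₀ : ℕ, AntitoneOn (fun k : ℕ => (c * (k : ℝ) ^ γ - (1 + 1) * Real.log k) / k) (Ici k₀) := by
  have hlog := (isLittleO_log_rpow_atTop hγ).bound (show 0 < c * (1 - γ) / 2 by
    have := sub_pos.2 hγ1; positivity)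
  obtain ⟨x₀, hx₀⟩ := eventually_atTop.1 (hlog.and (eventually_ge_atTop 1))
  set x₁ := max x₀ 1
  have hderiv : ∀ x : ℝ, 0 < x → HasDerivAt (fun x : ℝ => (c * x ^ γ - (1 + 1) * Real.log x) / x)
      (((c * (γ * x ^ (γ - 1)) - (1 + 1) * x⁻¹) * x - (c * x ^ γ - (1 + 1) * Real.log x) * 1) /
        x ^ 2) x := fun x hx =>
    (((Real.hasDerivAt_rpow_const (Or.inl hx.ne')).const_mul c).sub
      ((Real.hasDerivAt_log hx.ne').const_mul _)).div (hasDerivAt_id x) hx.ne'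
  have hpos : ∀ x ∈ Ici x₁, (0 : ℝ) < x := fun x hx =>
    zero_lt_one.trans_le ((le_max_right _ _).trans hx)
  have hanti : AntitoneOn (fun x : ℝ => (c * x ^ γ - (1 + 1) * Real.log x) / x) (Ici x₁) := by
    refine antitoneOn_of_deriv_nonpos (convex_Ici _)
      (fun x hx => (hderiv x (hpos x hx)).continuousAt.continuousWithinAt)
      (fun x hx => (hderiv x (hpos x (interior_subset hx))).differentiableAt.differentiableWithinAt)
      fun x hx => ?_
    have hx' := interior_subset hx
    have hx0 := hpos x hx'
    rw [(hderiv x hx0).deriv]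
    refine div_nonpos_of_nonpos_of_nonneg ?_ (sq_nonneg x)
    obtain ⟨h1, h2⟩ := hx₀ x ((le_max_left _ _).trans hx')
    rw [Real.norm_of_nonneg (Real.log_nonneg h2), Real.norm_of_nonneg (by positivity)] at h1
    have h3 : x ^ (γ - 1) * x = x ^ γ := by
      rw [← Real.rpow_add_one hx0.ne']; congr 1; ring
    have h4 : (c * (γ * x ^ (γ - 1)) - (1 + 1) * x⁻¹) * x = c * γ * (x ^ (γ - 1) * x) - 2 := by
      field_simp; ring
    rw [h4, h3]
    linarith
  refine ⟨⌈x₁⌉₊, fun i hi j hj hij => ?_⟩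
  exact hanti ((Nat.le_ceil x₁).trans (by exact_mod_cast (mem_Ici.1 hi)))
    ((Nat.le_ceil x₁).trans (by exact_mod_cast (mem_Ici.1 hj))) (by exact_mod_cast hij)

/-- Put `x = m / n`. From `(x^γ - 1) (n^γ - 1) ≥ 0` follows `c n^γ + c x^γ ≤ c m^γ + c`, and `exp
(-c x^γ)` beats `x^s`. -/
theorem exists_rpow_mul_exp_le {c γ : ℝ} (hc : 0 < c) (hγ : 0 < γ) (s : ℝ) :
    ∃ M : ℝ, 0 ≤ M ∧ ∀ n m : ℝ, 1 ≤ n → n ≤ m →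
      m ^ s * Real.exp (-(c * m ^ γ)) ≤ M * (n ^ s * Real.exp (-(c * n ^ γ))) := by
  set k := ⌈s / γ⌉₊ with hk
  set M := (k.factorial : ℝ) / c ^ k with hM
  have hM0 : 0 ≤ M := by positivity
  refine ⟨M * Real.exp c, by positivity, fun n m hn hnm => ?_⟩
  have hn0 : 0 < n := zero_lt_one.trans_le hn
  have hm0 : 0 < m := hn0.trans_le hnm
  set x := m / n with hx
  have hx1 : 1 ≤ x := (one_le_div hn0).2 hnm
  have hx0 : 0 < x := zero_lt_one.trans_le hx1
  have hm : m = x * n := by rw [hx, div_mul_cancel₀ _ hn0.ne']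
  have hy1 : 1 ≤ x ^ γ := Real.one_le_rpow hx1 hγ.le
  have h1 : x ^ s ≤ M * Real.exp (c * x ^ γ) := by
    have e1 : x ^ s = (x ^ γ) ^ (s / γ) := by
      rw [← Real.rpow_mul hx0.le, mul_div_cancel₀ _ hγ.ne']
    have e2 : (x ^ γ) ^ (s / γ) ≤ (x ^ γ) ^ k := by
      rw [← Real.rpow_natCast]
      exact Real.rpow_le_rpow_of_exponent_le hy1 (Nat.le_ceil _)
    have e3 := Real.pow_div_factorial_le_exp (c * x ^ γ) (by positivity) k
    rw [mul_pow, div_le_iff₀ (by positivity)] at e3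
    rw [e1]
    refine e2.trans ?_
    rw [hM, div_mul_eq_mul_div, le_div_iff₀ (by positivity)]
    linarith
  have h2 : c * n ^ γ + c * x ^ γ ≤ c * m ^ γ + c := by
    rw [hm, Real.mul_rpow hx0.le hn0.le]
    have : 1 ≤ n ^ γ := Real.one_le_rpow hn hγ.le
    have : 0 ≤ c * ((x ^ γ - 1) * (n ^ γ - 1)) :=
      mul_nonneg hc.le (mul_nonneg (by linarith) (by linarith))
    linarith
  calc m ^ s * Real.exp (-(c * m ^ γ))
      = x ^ s * (n ^ s * Real.exp (-(c * m ^ γ))) := by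
        conv_lhs => rw [hm, Real.mul_rpow hx0.le hn0.le, ← hm]
        ring
    _ ≤ M * Real.exp (c * x ^ γ) * (n ^ s * Real.exp (-(c * m ^ γ))) := by gcongr
    _ = M * n ^ s * Real.exp (c * x ^ γ + -(c * m ^ γ)) := by rw [Real.exp_add]; ring
    _ ≤ M * n ^ s * Real.exp (c + -(c * n ^ γ)) := by gcongr 2; linarith
    _ = _ := by rw [Real.exp_add]; ring

/-- Write `exp (-(c m^γ))` as `m^(-(1+ε))` times an almost decreasing function of `m`; the first
factor is summable and the second is bounded by its value at `n`. -/
theorem dominated_tsum_stretched {c γ ε : ℝ} (hc : 0 < c) (hγ : 0 < γ) (hε : 0 < ε) :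
    Dominated (fun n => ∑' j : ℕ, Real.exp (-(c * ((n + 1 + j : ℕ) : ℝ) ^ γ)))
      (fun n => (n : ℝ) ^ (1 + ε) * Real.exp (-(c * (n : ℝ) ^ γ))) := by
  obtain ⟨M, hM0, hM⟩ := exists_rpow_mul_exp_le hc hγ (1 + ε)
  have hsum : Summable fun j : ℕ => ((j + 1 : ℕ) : ℝ) ^ (-(1 + ε)) :=
    (summable_nat_add_iff 1).2 (Real.summable_nat_rpow.2 (by linarith))
  refine ⟨M * ∑' j : ℕ, ((j + 1 : ℕ) : ℝ) ^ (-(1 + ε)), fun n hn => ?_⟩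
  set q := (n : ℝ) ^ (1 + ε) * Real.exp (-(c * (n : ℝ) ^ γ)) with hq
  have hq0 : 0 ≤ q := by positivity
  have hle : ∀ j : ℕ, Real.exp (-(c * ((n + 1 + j : ℕ) : ℝ) ^ γ)) ≤
      ((j + 1 : ℕ) : ℝ) ^ (-(1 + ε)) * (M * q) := fun j => by
    have hm0 : (0 : ℝ) < ((n + 1 + j : ℕ) : ℝ) := by positivity
    have h1 := hM n ((n + 1 + j : ℕ) : ℝ) (by exact_mod_cast hn) (by
      exact_mod_cast (by omega : n ≤ n + 1 + j))
    calc Real.exp (-(c * ((n + 1 + j : ℕ) : ℝ) ^ γ))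
        = ((n + 1 + j : ℕ) : ℝ) ^ (-(1 + ε)) * (((n + 1 + j : ℕ) : ℝ) ^ (1 + ε) *
          Real.exp (-(c * ((n + 1 + j : ℕ) : ℝ) ^ γ))) := by
          rw [← mul_assoc, ← Real.rpow_add hm0, neg_add_cancel, Real.rpow_zero, one_mul]
      _ ≤ ((j + 1 : ℕ) : ℝ) ^ (-(1 + ε)) * (M * q) := by
          refine mul_le_mul ?_ h1 (by positivity) (by positivity)
          refine Real.rpow_le_rpow_of_nonpos (by positivity) ?_ (by linarith)
          exact_mod_cast (by omega : j + 1 ≤ n + 1 + j)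
  have h2 := (hsum.mul_right (M * q))
  calc ∑' j : ℕ, Real.exp (-(c * ((n + 1 + j : ℕ) : ℝ) ^ γ))
      ≤ ∑' j : ℕ, ((j + 1 : ℕ) : ℝ) ^ (-(1 + ε)) * (M * q) :=
        (Summable.of_nonneg_of_le (fun _ => (Real.exp_pos _).le) hle h2).tsum_le_tsum hle h2
    _ = _ := by rw [tsum_mul_right]; ring

theorem mainTheorem9 {X : Type*} [MeasurableSpace X] (S : InducingScheme X)
    {B : Type*} [NormedAddCommGroup B] [NormedSpace ℂ B] [CompleteSpace B]
    (E : ObservableSpace S.μ B) (hS : S.IsExcellent E) (hB : E.EmbedsInLinfty) :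
    (∀ c γ : ℝ, 0 < c → 0 < γ → γ < 1 →
      Dominated S.tail (fun n => Real.exp (-(c * (n : ℝ) ^ γ))) →
      ∀ ε : ℝ, 0 < ε →
        S.CorrDominated E (fun n => (n : ℝ) ^ (1 + ε) * Real.exp (-(c * (n : ℝ) ^ γ)))) ∧
    (∀ g : ℕ → ℝ, MonotoneOn g (Set.Ici 1) →
      (∃ δ : ℝ, 0 < δ ∧ Dominated g (fun n => (n : ℝ) ^ (1 - δ))) →
      (∃ η : ℝ, 0 < η ∧ ∃ k₀ : ℕ,
        AntitoneOn (fun k : ℕ => (g k - (1 + η) * Real.log k) / k) (Set.Ici k₀)) →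
      Dominated S.tail (fun n => Real.exp (-g n)) →
      ∀ ε : ℝ, 0 < ε →
        S.CorrDominated E
          (fun n => (n : ℝ) ^ (1 + ε) * Real.exp (-g n) + ∑' j : ℕ, S.tail (n + 1 + j)) ∧
        (Dominated (fun n => ∑' j : ℕ, Real.exp (-g (n + 1 + j)))
            (fun n => (n : ℝ) ^ (1 + ε) * Real.exp (-g n)) →
          S.CorrDominated E (fun n => (n : ℝ) ^ (1 + ε) * Real.exp (-g n)))) := by
  refine ⟨fun c γ hc hγ hγ1 hτ ε hε => ?_, fun g hg hgO ⟨η, hη, k₀, hanti⟩ hτ ε hε =>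
    ⟨S.corrDominated_of_tail_dominated hS hB hg hgO hη hanti hτ hε,
      S.corrDominated_of_tsum_dominated hS hB hg hgO hη hanti hτ hε⟩⟩
  -- The stretched exponential case is the general one with `g(n) = c n^γ`, `δ = 1 - γ` and `η = 1`.
  obtain ⟨k₀, hanti⟩ := exists_antitoneOn_stretched hc hγ hγ1
  refine S.corrDominated_of_tsum_dominated hS hB (g := fun n => c * (n : ℝ) ^ γ)
    (fun i _ j _ hij => ?_) ⟨1 - γ, sub_pos.2 hγ1, c, fun n _ => ?_⟩ one_pos hanti hτ hε
    (dominated_tsum_stretched hc hγ hε)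
  · simp only
    gcongr
  · simp
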